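/- Let $\alpha_B,\alpha_E,\lambda_B,\lambda_E,\Delta>0$ and $\mathcal A,\mathcal E\ge 0$ be real numbers such that $$\alpha_B\ge\alpha_E,\qquad \frac{\lambda_B}{\alpha_B}\le\frac{\lambda_E}{\alpha_E},$$ where at least one of the two inequalities is strict. For a real random variable $X\ge 0$, let $Y$ and $Z$ be random variables with values in $\{0,1,2,\dots\}$ such that, conditionally on $X=x$, $Y$ is Poisson distributed with mean $(\alpha_B x+\lambda_B)\Delta$ and $Z$ is Poisson distributed with mean $(\alpha_E x+\lambda_E)\Delta$ (the degraded discrete-time Poisson wiretap channel). Let $\Omega^+_{\mathcal A,\mathcal E}$ be the set of probability distributions $F_X$ of $X$ with $0\le X\le\mathcal A$ almost surely and $\mathbb E[X]\le\mathcal E$. Then for every $F_X\in\Omega^+_{\mathcal A,\mathcal E}$ the mutual informations $I(X;Y)$ and $I(X;Z)$ are finite, the secrecy capacity $$C_S=\sup_{F_X\in\Omega^+_{\mathcal A,\mathcal E}}\bigl[I(X;Y)-I(X;Z)\bigr]$$ is finite, and there is exactly one $F_X^*\in\Omega^+_{\mathcal A,\mathcal E}$ that attains this supremum. Moreover, the support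 of $F_X^*$ is a finite set. -/

import Mathlib

open MeasureTheory ProbabilityTheory InformationTheory
open scoped NNReal ENNReal

namespace PoissonWiretap

/-- The family `r ↦ Poisson(r)` is measurable in the mean. -/
theorem measurable_poissonMeasure : Measurable (poissonMeasure : ℝ≥0 → Measure ℕ) := by
  refine Measure.measurable_of_measurable_coe _ fun s _ => ?_
  have h : (fun r : ℝ≥0 => poissonMeasure r s)
      = fun r : ℝ≥0 => ∑' n : ℕ, s.indicator
          (fun n => ENNReal.ofReal (Real.exp (-(r : ℝ)) * (r : ℝ) ^ n / (n.factorial : ℝ))) n := by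
    funext r
    rw [← Measure.tsum_indicator_apply_singleton _ s (MeasurableSet.of_discrete)]
    refine tsum_congr fun n => ?_
    by_cases hn : n ∈ s <;> simp [hn, poissonMeasure_singleton]
  rw [h]
  refine Measurable.tsum fun n => ?_
  by_cases hn : n ∈ s
  · simp only [hn, Set.indicator_of_mem]
    fun_prop
  · simp [hn]

/-- The discrete-time Poisson channel with gain `α`, dark current `lam` and slot duration `Δ`:
given the input intensity `x`, the output is Poisson distributed with mean `(α x + lam) Δ`.
(The mean is truncated at zero, which is of no effect for nonnegative `x`.) -/
noncomputable def channel (α lam Δ : ℝ) : Kernel ℝ ℕ where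
  toFun x := poissonMeasure (Real.toNNReal ((α * x + lam) * Δ))
  measurable' := measurable_poissonMeasure.comp (by fun_prop)

instance (α lam Δ : ℝ) : IsMarkovKernel (channel α lam Δ) :=
  ⟨fun x => inferInstanceAs (IsProbabilityMeasure
    (poissonMeasure (Real.toNNReal ((α * x + lam) * Δ))))⟩

/-- The mutual information (in nats) between the input, with law `μ`, and the output of the
channel `κ`: the Kullback-Leibler divergence of the joint law from the product of the marginals. -/
noncomputable def mutualInfo {𝓧 𝓨 : Type*} [MeasurableSpace 𝓧] [MeasurableSpace 𝓨]
    (μ : Measure 𝓧) (κ : Kernel 𝓧 𝓨) : ℝ≥0∞ :=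
  klDiv (μ ⊗ₘ κ) (μ.prod (κ ∘ₘ μ))

/-- The input distributions that are supported in `[0, A]` and have mean at most `E`. -/
def feasible (A E : ℝ) : Set (ProbabilityMeasure ℝ) :=
  {μ | (μ : Measure ℝ) (Set.Icc 0 A) = 1 ∧ ∫ x, x ∂(μ : Measure ℝ) ≤ E}

/-- The objective `I(X;Y) - I(X;Z)` as a functional of the law `μ` of `X`, where `Y` and `Z` are
the outputs of the channels `κB` and `κE`. It is meaningful where both terms are finite. -/
noncomputable def secrecyRate (κB κE : Kernel ℝ ℕ) (μ : ProbabilityMeasure ℝ) : ℝ :=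
  (mutualInfo (μ : Measure ℝ) κB).toReal - (mutualInfo (μ : Measure ℝ) κE).toReal

/-- The secrecy capacity: the supremum of `I(X;Y) - I(X;Z)` over the feasible input laws. -/
noncomputable def secrecyCapacity (κB κE : Kernel ℝ ℕ) (A E : ℝ) : ℝ :=
  sSup (secrecyRate κB κE '' feasible A E)

end PoissonWiretap

/-!
A Poisson output with mean `m x` has mutual information `∫ i_μ (m x) dμ` with its input, where
`i_μ r = r log r - r - Q_μ r` for an entire function `Q_μ` which depends on the output law of `μ`.
Evaluating the density `i_μ` of `μ` under another law `ν` gives the mutual information of `ν` plus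
the relative entropy of the output laws of `ν` and `μ`.

The eavesdropper's count is a thinning of the legitimate one plus independent dark counts. By the
data processing inequality the secrecy rate of `ν` is therefore at most the integral of the secrecy
density of `μ`, strictly unless the output laws agree; and a mixed Poisson law determines its
mixing law. So the secrecy rate is strictly concave, and its maximizer, which exists by weak
compactness, is unique.

At the maximizer, perturbations with density `1 + t h` change the relative entropies only by
`O(t ^ 2)`, so the secrecy density is an affine function of the intensity almost everywhere. If the
support were infinite, analytic continuation would make
`r log r - (p r + δ) log (p r + δ)` agree on `(0, ∞)` with an entire function, but it is not
differentiable at `0`.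
-/

namespace PoissonWiretap

open Real Set Filter Topology
open scoped Nat

/-! ### Poisson averages -/

/-- The mass at `k` of the Poisson distribution with mean `r`. Mathlib's `poissonPMFReal` takes
`r : ℝ≥0`; real means are needed here because averages are continued analytically to `r < 0`. -/
noncomputable def poissonWeight (r : ℝ) (k : ℕ) : ℝ :=
  exp (-r) * r ^ k / k !

/-- The average of the sequence `f` under the Poisson distribution with mean `r`. -/
noncomputable def poissonAverage (f : ℕ → ℝ) (r : ℝ) : ℝ :=
  ∑' k, poissonWeight r k * f k

/-- The growth condition on `f` under which its Poisson averages are entire functions of the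
mean. -/
def PoissonSummable (f : ℕ → ℝ) : Prop :=
  ∀ r : ℝ, Summable fun k => r ^ k / k ! * f k

theorem poissonWeight_nonneg {r : ℝ} (hr : 0 ≤ r) (k : ℕ) : 0 ≤ poissonWeight r k := by
  unfold poissonWeight; positivity

theorem poissonWeight_pos {r : ℝ} (hr : 0 < r) (k : ℕ) : 0 < poissonWeight r k := by
  unfold poissonWeight; positivity

theorem poissonWeight_zero_right (r : ℝ) : poissonWeight r 0 = exp (-r) := by
  simp [poissonWeight]

theorem poissonWeight_le {r M : ℝ} (hr : 0 ≤ r) (hM : r ≤ M) (k : ℕ) :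
    poissonWeight r k ≤ M ^ k / k ! := by
  unfold poissonWeight
  gcongr
  calc exp (-r) * r ^ k ≤ 1 * M ^ k := by gcongr; exact exp_le_one_iff.2 (neg_nonpos.2 hr)
    _ = M ^ k := one_mul _

theorem hasSum_poissonWeight (r : ℝ) : HasSum (poissonWeight r) 1 := by
  have h := (NormedSpace.expSeries_div_hasSum_exp (r : ℝ)).mul_left (exp (-r))
  rw [← exp_eq_exp_ℝ, ← exp_add, neg_add_cancel, exp_zero] at h
  exact (funext fun k => mul_div_assoc _ _ _ : poissonWeight r = _) ▸ h

theorem poissonWeight_succ_mul (r : ℝ) (k : ℕ) :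
    poissonWeight r (k + 1) * (k + 1 : ℕ) = r * poissonWeight r k := by
  unfold poissonWeight
  rw [Nat.factorial_succ]
  push_cast
  field_simp
  ring

theorem hasSum_poissonWeight_mul_natCast (r : ℝ) :
    HasSum (fun k : ℕ => poissonWeight r k * k) r := by
  rw [← hasSum_nat_add_iff' 1]
  simpa [-Nat.cast_add, poissonWeight_succ_mul] using (hasSum_poissonWeight r).mul_left r

theorem poissonAverage_one (r : ℝ) : poissonAverage (fun _ => 1) r = 1 := by
  simpa [poissonAverage] using (hasSum_poissonWeight r).tsum_eq

theorem poissonAverage_pow (t r : ℝ) : poissonAverage (fun k => (1 + t) ^ k) r = exp (t * r) := by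
  have h : ∀ k : ℕ, poissonWeight r k * (1 + t) ^ k
      = exp (t * r) * poissonWeight ((1 + t) * r) k := fun k => by
    have hexp : exp (-r) = exp (t * r) * exp (-((1 + t) * r)) := by
      rw [← exp_add]; congr 1; ring
    rw [poissonWeight, poissonWeight, hexp, mul_pow]
    ring
  simp only [poissonAverage, h, tsum_mul_left, (hasSum_poissonWeight _).tsum_eq, mul_one]

namespace PoissonSummable

variable {f g : ℕ → ℝ} {r M : ℝ}

theorem of_abs_le (hg : PoissonSummable g) (h : ∀ k, |f k| ≤ g k) : PoissonSummable f := fun r =>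
  (hg |r|).of_norm_bounded fun k => by
    rw [norm_mul, norm_div, norm_pow, norm_eq_abs, norm_eq_abs, norm_eq_abs, Nat.abs_cast]
    gcongr
    exact h k

theorem abs (hf : PoissonSummable f) : PoissonSummable fun k => |f k| := fun r =>
  (hf |r|).norm.of_norm_bounded fun k => by simp

theorem const_mul_pow (c b : ℝ) : PoissonSummable fun k => c * b ^ k := fun r =>
  ((summable_pow_div_factorial (r * b)).mul_left c).congr fun k => by rw [mul_pow]; ring

theorem of_abs_le_linear {a b : ℝ} (ha : 0 ≤ a) (hb : 0 ≤ b) (h : ∀ k : ℕ, |f k| ≤ a + b * k) :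
    PoissonSummable f :=
  (const_mul_pow (a + b) 2).of_abs_le fun k => by
    have hk : (k : ℝ) ≤ 2 ^ k := by exact_mod_cast Nat.lt_two_pow_self.le
    calc |f k| ≤ a * 1 + b * k := by simpa using h k
      _ ≤ a * 2 ^ k + b * 2 ^ k := by gcongr; exact one_le_pow₀ one_le_two
      _ = (a + b) * 2 ^ k := by ring

theorem const_add_mul_natCast (a b : ℝ) : PoissonSummable fun k : ℕ => a + b * k :=
  of_abs_le_linear (abs_nonneg a) (abs_nonneg b) fun k => by
    simpa [abs_mul] using abs_add_le a (b * k)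

theorem abs_poissonWeight_mul_le (hr : 0 ≤ r) (hM : r ≤ M) (k : ℕ) :
    |poissonWeight r k * f k| ≤ M ^ k / k ! * |f k| := by
  rw [abs_mul, abs_of_nonneg (poissonWeight_nonneg hr k)]
  gcongr
  exact poissonWeight_le hr hM k

theorem summable (hf : PoissonSummable f) (r : ℝ) : Summable fun k => poissonWeight r k * f k :=
  ((hf r).mul_left (exp (-r))).congr fun k => by unfold poissonWeight; ring

theorem analyticAt_poissonAverage (hf : PoissonSummable f) (r : ℝ) :
    AnalyticAt ℝ (poissonAverage f) r := by
  let p := FormalMultilinearSeries.ofScalars ℝ fun k : ℕ => f k / (k ! : ℝ)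
  have hradius : p.radius = ⊤ := by
    refine p.radius_eq_top_of_summable_norm fun r => (hf r).norm.congr fun k => ?_
    rw [FormalMultilinearSeries.ofScalars_norm, norm_mul, norm_div, norm_div, norm_pow]
    simp only [norm_eq_abs, NNReal.abs_eq]
    ring
  have hp : AnalyticAt ℝ p.sum r :=
    (p.hasFPowerSeriesOnBall (by simp [hradius])).analyticAt_of_mem (by simp [hradius])
  have heq : poissonAverage f = fun r => exp (-r) * p.sum r := by
    funext r
    rw [show p.sum r = ∑' k, (f k / (k ! : ℝ)) • r ^ k from
      FormalMultilinearSeries.ofScalars_sum_eq _ r, ← tsum_mul_left]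
    exact tsum_congr fun k => by rw [poissonWeight, smul_eq_mul]; ring
  rw [heq]
  exact (analyticAt_rexp.comp analyticAt_id.neg).mul hp

theorem continuous_poissonAverage (hf : PoissonSummable f) : Continuous (poissonAverage f) :=
  continuous_iff_continuousAt.2 fun r => (hf.analyticAt_poissonAverage r).continuousAt

end PoissonSummable

/-! ### Mixed Poisson laws -/

/-- The function `m` assigns to a `μ`-distributed input the mean of a Poisson output, and these
means lie in a compact subinterval `[l, M]` of `(0, ∞)`. -/
structure IsIntensity {X : Type*} [MeasurableSpace X] (m : X → ℝ) (μ : Measure X) (l M : ℝ) :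
    Prop where
  measurable : Measurable m
  pos : 0 < l
  ae_mem : ∀ᵐ x ∂μ, m x ∈ Icc l M

/-- The law of the Poisson output with mean `m x` when the input `x` has law `μ`. -/
noncomputable def outputPMF {X : Type*} [MeasurableSpace X] (m : X → ℝ) (μ : Measure X) (k : ℕ) :
    ℝ :=
  ∫ x, poissonWeight (m x) k ∂μ

/-- The logarithm of the output law relative to the weights `1 / k!`. Unlike the logarithm of the
output law itself it grows only linearly, and the factorials cancel in all relative entropies. -/
noncomputable def logOutput {X : Type*} [MeasurableSpace X] (m : X → ℝ) (μ : Measure X) (k : ℕ) :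
    ℝ :=
  log (k ! * outputPMF m μ k)

section MixedPoisson

variable {X : Type*} [MeasurableSpace X] {m : X → ℝ} {μ ν : Measure X} {l M : ℝ} {f : ℕ → ℝ}

theorem continuous_poissonWeight (k : ℕ) : Continuous fun r => poissonWeight r k := by
  unfold poissonWeight; fun_prop

namespace IsIntensity

theorem ae_pos (hm : IsIntensity m μ l M) : ∀ᵐ x ∂μ, 0 < m x :=
  hm.ae_mem.mono fun _ hx => hm.pos.trans_le hx.1

theorem of_absolutelyContinuous (hm : IsIntensity m μ l M) (h : ν ≪ μ) : IsIntensity m ν l M :=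
  ⟨hm.measurable, hm.pos, h.ae_le hm.ae_mem⟩

theorem mul_add (hm : IsIntensity m μ l M) {p δ : ℝ} (hp : 0 < p) (hδ : 0 ≤ δ) :
    IsIntensity (fun x => p * m x + δ) μ (p * l + δ) (p * M + δ) where
  measurable := (hm.measurable.const_mul p).add_const δ
  pos := by have := hm.pos; positivity
  ae_mem := hm.ae_mem.mono fun x hx => by
    constructor <;> gcongr
    exacts [hx.1, hx.2]

theorem integrable_comp [IsFiniteMeasure μ] (hm : IsIntensity m μ l M) {g : ℝ → ℝ}
    (hg : ContinuousOn g (Icc l M)) : Integrable (fun x => g (m x)) μ := by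
  have h : IntegrableOn g (Icc l M) (μ.map m) := hg.integrableOn_compact isCompact_Icc
  have hmap : ∀ᵐ r ∂μ.map m, r ∈ Icc l M :=
    (ae_map_iff hm.measurable.aemeasurable measurableSet_Icc).2 hm.ae_mem
  rw [IntegrableOn, Measure.restrict_eq_self_of_ae_mem hmap] at h
  exact h.comp_measurable hm.measurable

variable [IsProbabilityMeasure μ]

theorem upper_pos (hm : IsIntensity m μ l M) : 0 < M := by
  obtain ⟨x, hx⟩ := hm.ae_mem.exists
  exact hm.pos.trans_le (hx.1.trans hx.2)

theorem integrable_poissonWeight (hm : IsIntensity m μ l M) (k : ℕ) :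
    Integrable (fun x => poissonWeight (m x) k) μ :=
  hm.integrable_comp (continuous_poissonWeight k).continuousOn

theorem le_outputPMF (hm : IsIntensity m μ l M) (k : ℕ) :
    exp (-M) * l ^ k / k ! ≤ outputPMF m μ k := by
  have hl := hm.pos
  refine (integral_mono_ae (integrable_const (exp (-M) * l ^ k / k !))
    (hm.integrable_poissonWeight k) (hm.ae_mem.mono fun x hx => ?_)).trans' (by simp)
  simp only [poissonWeight]
  gcongr
  exacts [hx.2, hx.1]

theorem outputPMF_le (hm : IsIntensity m μ l M) (k : ℕ) : outputPMF m μ k ≤ M ^ k / k ! := by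
  refine (integral_mono_ae (hm.integrable_poissonWeight k) (integrable_const (M ^ k / k !))
    (hm.ae_mem.mono fun x hx => ?_)).trans (by simp)
  exact poissonWeight_le (hm.pos.le.trans hx.1) hx.2 k

theorem outputPMF_pos (hm : IsIntensity m μ l M) (k : ℕ) : 0 < outputPMF m μ k :=
  (hm.le_outputPMF k).trans_lt' (by have := hm.pos; positivity)

theorem abs_logOutput_le (hm : IsIntensity m μ l M) (k : ℕ) :
    |logOutput m μ k| ≤ M + (|log l| + |log M|) * k := by
  have hl := hm.pos
  have hM := hm.upper_pos
  have hP := hm.outputPMF_pos k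
  have hlower : -M + k * log l ≤ logOutput m μ k := by
    rw [← log_pow, ← log_exp (-M), ← log_mul (by positivity) (by positivity)]
    refine log_le_log (by positivity) ?_
    rw [mul_comm (k ! : ℝ), ← div_le_iff₀ (by positivity)]
    exact hm.le_outputPMF k
  have hupper : logOutput m μ k ≤ k * log M := by
    rw [← log_pow]
    refine log_le_log (by positivity) ?_
    rw [mul_comm (k ! : ℝ), ← le_div_iff₀ (by positivity)]
    exact hm.outputPMF_le k
  refine abs_le.2 ⟨?_, ?_⟩
  · nlinarith [neg_abs_le (log l), abs_nonneg (log M), k.cast_nonneg (α := ℝ)]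
  · nlinarith [le_abs_self (log M), abs_nonneg (log l), k.cast_nonneg (α := ℝ)]

theorem poissonSummable_logOutput (hm : IsIntensity m μ l M) : PoissonSummable (logOutput m μ) :=
  .of_abs_le_linear hm.upper_pos.le (by positivity) hm.abs_logOutput_le

theorem hasSum_outputPMF_mul (hm : IsIntensity m μ l M) (hf : PoissonSummable f) :
    HasSum (fun k => outputPMF m μ k * f k) (∫ x, poissonAverage f (m x) ∂μ) := by
  have hint : ∀ k, Integrable (fun x => poissonWeight (m x) k * f k) μ := fun k =>
    (hm.integrable_poissonWeight k).mul_const _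
  have hbound : ∀ k, ∫ x, ‖poissonWeight (m x) k * f k‖ ∂μ ≤ M ^ k / k ! * |f k| := fun k =>
    (integral_mono_ae (hint k).norm (integrable_const _) (hm.ae_mem.mono fun x hx =>
      PoissonSummable.abs_poissonWeight_mul_le (hm.pos.le.trans hx.1) hx.2 k)).trans (by simp)
  have h := hasSum_integral_of_summable_integral_norm hint
    ((hf.abs M).of_nonneg_of_le (fun k => by positivity) hbound)
  simp only [integral_mul_const] at h
  exact h

theorem hasSum_outputPMF (hm : IsIntensity m μ l M) : HasSum (outputPMF m μ) 1 := by
  simpa [poissonAverage_one] using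
    hm.hasSum_outputPMF_mul (f := fun _ => 1) (by simpa using PoissonSummable.const_mul_pow 1 1)

end IsIntensity

end MixedPoisson

/-! ### Relative entropy of sequences and data processing -/

/-- The relative entropy of the discrete distribution `a` with respect to `b`. -/
noncomputable def relEntropy {ι : Type*} (a b : ι → ℝ) : ℝ :=
  ∑' k, a k * log (a k / b k)

/-- A discrete probability distribution that charges every point. -/
structure IsPositivePMF {ι : Type*} (a : ι → ℝ) : Prop where
  pos : ∀ k, 0 < a k
  hasSum_one : HasSum a 1

/-- `W k j` is the probability of the output `j` given the input `k` of a discrete channel. -/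
structure IsStochastic {ι κ : Type*} (W : ι → κ → ℝ) : Prop where
  nonneg : ∀ k j, 0 ≤ W k j
  hasSum_one : ∀ k, HasSum (W k) 1

section RelEntropy

variable {ι κ : Type*} {a b : ι → ℝ}

theorem relEntropy_self (a : ι → ℝ) : relEntropy a a = 0 := by
  refine (tsum_congr fun k => ?_).trans tsum_zero
  rcases eq_or_ne (a k) 0 with h | h <;> simp [h]

theorem klFun_le_sq {x : ℝ} (hx : 0 ≤ x) : klFun x ≤ (x - 1) ^ 2 := by
  rcases hx.eq_or_lt with rfl | hx
  · simp [klFun_zero]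
  · rw [klFun_apply]
    nlinarith [mul_le_mul_of_nonneg_left (log_le_sub_one_of_pos hx) hx.le]

namespace IsPositivePMF

theorem hasSum_mul_klFun (ha : IsPositivePMF a) (hb : IsPositivePMF b)
    (hs : Summable fun k => a k * log (a k / b k)) :
    HasSum (fun k => b k * klFun (a k / b k)) (relEntropy a b) := by
  have h := (hs.hasSum.add hb.hasSum_one).sub ha.hasSum_one
  rw [add_sub_cancel_right] at h
  refine (congrArg (HasSum · _) (funext fun k => ?_)).mp h
  have := (hb.pos k).ne'
  rw [klFun_apply]
  field_simp

theorem relEntropy_nonneg (ha : IsPositivePMF a) (hb : IsPositivePMF b)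
    (hs : Summable fun k => a k * log (a k / b k)) : 0 ≤ relEntropy a b :=
  (ha.hasSum_mul_klFun hb hs).nonneg fun k =>
    mul_nonneg (hb.pos k).le (klFun_nonneg (div_pos (ha.pos k) (hb.pos k)).le)

theorem relEntropy_le_sq {ε : ℝ} (ha : IsPositivePMF a) (hb : IsPositivePMF b)
    (hs : Summable fun k => a k * log (a k / b k)) (h : ∀ k, |a k - b k| ≤ ε * b k) :
    relEntropy a b ≤ ε ^ 2 := by
  have hterm : ∀ k, b k * klFun (a k / b k) ≤ ε ^ 2 * b k := fun k => by
    have hratio : |a k / b k - 1| ≤ ε := by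
      rw [div_sub_one (hb.pos k).ne', abs_div, abs_of_pos (hb.pos k), div_le_iff₀ (hb.pos k)]
      exact h k
    have hkl := (klFun_le_sq (div_pos (ha.pos k) (hb.pos k)).le).trans
      (sq_le_sq.2 (hratio.trans (le_abs_self ε)))
    rw [mul_comm]
    exact mul_le_mul_of_nonneg_right hkl (hb.pos k).le
  simpa using hasSum_le hterm (ha.hasSum_mul_klFun hb hs) (hb.hasSum_one.mul_left (ε ^ 2))

end IsPositivePMF

theorem hasSum_prod_mul {F : ι → κ → ℝ} {r u : ι → ℝ} {s : ℝ} (hF : ∀ i j, 0 ≤ F i j)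
    (hr : ∀ i, HasSum (F i) (r i)) (hu : HasSum (fun i => u i * r i) s) :
    HasSum (fun q : ι × κ => u q.1 * F q.1 q.2) s := by
  have hrow : ∀ i, HasSum (fun j => u i * F i j) (u i * r i) := fun i => (hr i).mul_left _
  have hrow_abs : ∀ i, HasSum (fun j => |u i * F i j|) |u i * r i| := fun i => by
    simpa only [abs_mul, abs_of_nonneg (hF i _), abs_of_nonneg ((hr i).nonneg (hF i))]
      using (hr i).mul_left |u i|
  have hsum : Summable fun q : ι × κ => u q.1 * F q.1 q.2 := by
    rw [← summable_abs_iff, summable_prod_of_nonneg fun _ => abs_nonneg _]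
    exact ⟨fun i => (hrow_abs i).summable, hu.summable.abs.congr fun i => (hrow_abs i).tsum_eq.symm⟩
  exact (hsum.hasSum.prod_fiberwise hrow).unique hu ▸ hsum.hasSum

theorem hasSum_prod_mul_swap {F : ι → κ → ℝ} {r u : κ → ℝ} {s : ℝ} (hF : ∀ i j, 0 ≤ F i j)
    (hr : ∀ j, HasSum (fun i => F i j) (r j)) (hu : HasSum (fun j => u j * r j) s) :
    HasSum (fun q : ι × κ => u q.2 * F q.1 q.2) s :=
  (Equiv.prodComm ι κ).hasSum_iff.2 (hasSum_prod_mul (fun j i => hF i j) hr hu)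

theorem mul_klFun_div_div {x y v : ℝ} (hx : 0 < x) (hy : 0 < y) (hv : 0 < v) :
    y * v * klFun (x / y / v) = x * log (x / y) - x * log v - x + y * v := by
  rw [klFun_apply, log_div (div_pos hx hy).ne' hv.ne']
  field_simp
  ring

namespace IsStochastic

variable {W : ι → κ → ℝ} {a' b' : κ → ℝ}

/-- Each transition `(k, j)` contributes to the loss of relative entropy a nonnegative term that
compares the likelihood ratio of the input `k` with that of the output `j`. -/
theorem hasSum_relEntropy_sub (hW : IsStochastic W) (ha : IsPositivePMF a) (hb : IsPositivePMF b)
    (ha' : IsPositivePMF a') (hb' : IsPositivePMF b')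
    (haW : ∀ j, HasSum (fun k => a k * W k j) (a' j))
    (hbW : ∀ j, HasSum (fun k => b k * W k j) (b' j))
    (hs : Summable fun k => a k * log (a k / b k))
    (hs' : Summable fun j => a' j * log (a' j / b' j)) :
    HasSum (fun q : ι × κ => W q.1 q.2 *
        (b q.1 * (a' q.2 / b' q.2) * klFun (a q.1 / b q.1 / (a' q.2 / b' q.2))))
      (relEntropy a b - relEntropy a' b') := by
  have hinput : HasSum (fun q : ι × κ => a q.1 * log (a q.1 / b q.1) * W q.1 q.2)
      (relEntropy a b) :=
    hasSum_prod_mul (u := fun k => a k * log (a k / b k)) hW.nonneg hW.hasSum_one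
      (by simpa only [mul_one, relEntropy] using hs.hasSum)
  have houtput : HasSum (fun q : ι × κ => log (a' q.2 / b' q.2) * (a q.1 * W q.1 q.2))
      (relEntropy a' b') :=
    hasSum_prod_mul_swap (F := fun k j => a k * W k j) (u := fun j => log (a' j / b' j))
      (fun k j => mul_nonneg (ha.pos k).le (hW.nonneg k j)) haW
      (by simpa only [mul_comm (log _), relEntropy] using hs'.hasSum)
  have hmass : HasSum (fun q : ι × κ => a q.1 * W q.1 q.2) 1 :=
    hasSum_prod_mul (u := a) hW.nonneg hW.hasSum_one
      (by simpa only [mul_one] using ha.hasSum_one)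
  have hratio : HasSum (fun q : ι × κ => a' q.2 / b' q.2 * (b q.1 * W q.1 q.2)) 1 :=
    hasSum_prod_mul_swap (F := fun k j => b k * W k j) (u := fun j => a' j / b' j)
      (fun k j => mul_nonneg (hb.pos k).le (hW.nonneg k j)) hbW
      (by simpa only [div_mul_cancel₀ _ (hb'.pos _).ne'] using ha'.hasSum_one)
  have h := ((hinput.sub houtput).sub hmass).add hratio
  rw [sub_add_cancel] at h
  refine (congrArg (HasSum · _) (funext fun q => ?_)).mp h
  rw [mul_klFun_div_div (ha.pos _) (hb.pos _) (div_pos (ha'.pos _) (hb'.pos _))]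
  ring

theorem transition_nonneg (hW : IsStochastic W) (ha : IsPositivePMF a) (hb : IsPositivePMF b)
    (ha' : IsPositivePMF a') (hb' : IsPositivePMF b') (q : ι × κ) :
    0 ≤ W q.1 q.2 *
      (b q.1 * (a' q.2 / b' q.2) * klFun (a q.1 / b q.1 / (a' q.2 / b' q.2))) := by
  have hv := div_pos (ha'.pos q.2) (hb'.pos q.2)
  have hu := div_pos (ha.pos q.1) (hb.pos q.1)
  exact mul_nonneg (hW.nonneg _ _) (mul_nonneg (mul_pos (hb.pos _) hv).le
    (klFun_nonneg (div_pos hu hv).le))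

theorem relEntropy_le (hW : IsStochastic W) (ha : IsPositivePMF a) (hb : IsPositivePMF b)
    (ha' : IsPositivePMF a') (hb' : IsPositivePMF b')
    (haW : ∀ j, HasSum (fun k => a k * W k j) (a' j))
    (hbW : ∀ j, HasSum (fun k => b k * W k j) (b' j))
    (hs : Summable fun k => a k * log (a k / b k))
    (hs' : Summable fun j => a' j * log (a' j / b' j)) :
    relEntropy a' b' ≤ relEntropy a b :=
  sub_nonneg.1 <| (hW.hasSum_relEntropy_sub ha hb ha' hb' haW hbW hs hs').nonneg
    (hW.transition_nonneg ha hb ha' hb')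

theorem eq_of_relEntropy_eq (hW : IsStochastic W) (ha : IsPositivePMF a) (hb : IsPositivePMF b)
    (ha' : IsPositivePMF a') (hb' : IsPositivePMF b')
    (haW : ∀ j, HasSum (fun k => a k * W k j) (a' j))
    (hbW : ∀ j, HasSum (fun k => b k * W k j) (b' j))
    (hs : Summable fun k => a k * log (a k / b k))
    (hs' : Summable fun j => a' j * log (a' j / b' j))
    (heq : relEntropy a' b' = relEntropy a b) {i : ι}
    (hconn : ∀ k, ∃ j, 0 < W i j ∧ 0 < W k j) : a = b := by
  have hsum := hW.hasSum_relEntropy_sub ha hb ha' hb' haW hbW hs hs'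
  rw [heq, sub_self, hasSum_zero_iff_of_nonneg (hW.transition_nonneg ha hb ha' hb')] at hsum
  have hratio : ∀ k j, 0 < W k j → a k / b k = a' j / b' j := fun k j hkj => by
    have hv := div_pos (ha'.pos j) (hb'.pos j)
    have hzero : W k j * (b k * (a' j / b' j) * klFun (a k / b k / (a' j / b' j))) = 0 :=
      congrFun hsum (k, j)
    have hkl := (mul_eq_zero.1 ((mul_eq_zero.1 hzero).resolve_left hkj.ne')).resolve_left
      (mul_pos (hb.pos k) hv).ne'
    rwa [klFun_eq_zero_iff (div_pos (div_pos (ha.pos k) (hb.pos k)) hv).le,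
      div_eq_one_iff_eq hv.ne'] at hkl
  have hprop : ∀ k, a k = a i / b i * b k := fun k => by
    obtain ⟨j, hij, hkj⟩ := hconn k
    rw [hratio i j hij, ← hratio k j hkj, div_mul_cancel₀ _ (hb.pos k).ne']
  have hone : 1 = a i / b i := by
    have h := hb.hasSum_one.mul_left (a i / b i)
    rw [← funext hprop, mul_one] at h
    exact ha.hasSum_one.unique h
  exact funext fun k => by rw [hprop k, ← hone, one_mul]

end IsStochastic

end RelEntropy

/-! ### Information rates of Poisson channels -/

/-- The relative entropy of the Poisson distribution with mean `r` with respect to the output law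
`outputPMF m μ`, written so that it makes sense for every real `r`. -/
noncomputable def infoDensity {X : Type*} [MeasurableSpace X] (m : X → ℝ) (μ : Measure X) (r : ℝ) :
    ℝ :=
  r * log r - r - poissonAverage (logOutput m μ) r

/-- The mutual information between an input `x` with law `μ` and a Poisson output with mean
`m x`. -/
noncomputable def infoRate {X : Type*} [MeasurableSpace X] (m : X → ℝ) (μ : Measure X) : ℝ :=
  ∫ x, infoDensity m μ (m x) ∂μ

namespace IsIntensity

variable {X : Type*} [MeasurableSpace X] {m : X → ℝ} {μ ν : Measure X} {l M : ℝ}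
  [IsProbabilityMeasure μ] [IsProbabilityMeasure ν]

theorem isPositivePMF_outputPMF (hm : IsIntensity m μ l M) : IsPositivePMF (outputPMF m μ) :=
  ⟨hm.outputPMF_pos, hm.hasSum_outputPMF⟩

theorem continuous_infoDensity (hm : IsIntensity m μ l M) : Continuous (infoDensity m μ) :=
  (continuous_mul_log.sub continuous_id).sub hm.poissonSummable_logOutput.continuous_poissonAverage

theorem integrable_infoDensity (hμ : IsIntensity m μ l M) (hν : IsIntensity m ν l M) :
    Integrable (fun x => infoDensity m μ (m x)) ν :=
  hν.integrable_comp hμ.continuous_infoDensity.continuousOn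

theorem integral_infoDensity_eq_sub_tsum (hμ : IsIntensity m μ l M) (hν : IsIntensity m ν l M) :
    ∫ x, infoDensity m μ (m x) ∂ν =
      ∫ x, (m x * log (m x) - m x) ∂ν - ∑' k, outputPMF m ν k * logOutput m μ k := by
  rw [(hν.hasSum_outputPMF_mul hμ.poissonSummable_logOutput).tsum_eq]
  exact integral_sub
    (hν.integrable_comp (continuous_mul_log.sub continuous_id).continuousOn)
    (hν.integrable_comp
      hμ.poissonSummable_logOutput.continuous_poissonAverage.continuousOn)

theorem hasSum_relEntropy_outputPMF (hμ : IsIntensity m μ l M) (hν : IsIntensity m ν l M) :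
    HasSum (fun k => outputPMF m ν k * log (outputPMF m ν k / outputPMF m μ k))
      (∑' k, outputPMF m ν k * logOutput m ν k - ∑' k, outputPMF m ν k * logOutput m μ k) := by
  have h := (hν.hasSum_outputPMF_mul hν.poissonSummable_logOutput).summable.hasSum.sub
    (hν.hasSum_outputPMF_mul hμ.poissonSummable_logOutput).summable.hasSum
  refine (congrArg (HasSum · _) (funext fun k => ?_)).mp h
  have hk : (k ! : ℝ) ≠ 0 := by positivity
  have hPν := (hν.outputPMF_pos k).ne'
  have hPμ := (hμ.outputPMF_pos k).ne'
  rw [logOutput, logOutput, log_mul hk hPν, log_mul hk hPμ, log_div hPν hPμ]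
  ring

theorem integral_infoDensity (hμ : IsIntensity m μ l M) (hν : IsIntensity m ν l M) :
    ∫ x, infoDensity m μ (m x) ∂ν =
      infoRate m ν + relEntropy (outputPMF m ν) (outputPMF m μ) := by
  rw [infoRate, relEntropy, (hμ.hasSum_relEntropy_outputPMF hν).tsum_eq,
    hμ.integral_infoDensity_eq_sub_tsum hν, hν.integral_infoDensity_eq_sub_tsum hν]
  ring

end IsIntensity

/-! ### Thinning and adding dark counts -/

/-- The probability of keeping `i` out of `k` counts when each is kept independently with
probability `p`. -/
noncomputable def thinning (p : ℝ) (k i : ℕ) : ℝ :=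
  k.choose i * p ^ i * (1 - p) ^ (k - i)

theorem thinning_zero_right (p : ℝ) (k : ℕ) : thinning p k 0 = (1 - p) ^ k := by
  simp [thinning]

theorem thinning_self (p : ℝ) (k : ℕ) : thinning p k k = p ^ k := by
  simp [thinning]

/-- The probability of output `j` given input `k`, when the `k` input counts are thinned with
parameter `p` and an independent Poisson number of dark counts with mean `δ` is added. -/
noncomputable def degradation (p δ : ℝ) (k j : ℕ) : ℝ :=
  ∑ q ∈ Finset.HasAntidiagonal.antidiagonal j, thinning p k q.1 * poissonWeight δ q.2

/-- The parameters for which `degradation p δ` is a channel that does lose information. -/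
structure IsStrictDegradation (p δ : ℝ) : Prop where
  pos : 0 < p
  le_one : p ≤ 1
  nonneg : 0 ≤ δ
  strict : p < 1 ∨ 0 < δ

section Degradation

variable {p δ : ℝ}

theorem hasSum_thinning (p : ℝ) (k : ℕ) : HasSum (thinning p k) 1 := by
  have hsum : ∑ i ∈ Finset.range (k + 1), thinning p k i = 1 := by
    have h := add_pow p (1 - p) k
    rw [add_sub_cancel, one_pow] at h
    exact (h.trans (Finset.sum_congr rfl fun i _ => by rw [thinning]; ring)).symm
  exact hsum ▸ hasSum_sum_of_ne_finset_zero fun i hi => by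
    rw [thinning, Nat.choose_eq_zero_of_lt (by simpa [Nat.lt_succ_iff] using hi)]
    simp

theorem hasSum_poissonWeight_mul_thinning (r p : ℝ) (i : ℕ) :
    HasSum (fun k => poissonWeight r k * thinning p k i) (poissonWeight (p * r) i) := by
  have hbelow : ∑ k ∈ Finset.range i, poissonWeight r k * thinning p k i = 0 :=
    Finset.sum_eq_zero fun k hk => by
      rw [thinning, Nat.choose_eq_zero_of_lt (Finset.mem_range.1 hk)]
      simp
  rw [← hasSum_nat_add_iff' i, hbelow, sub_zero]
  have h := (hasSum_poissonWeight ((1 - p) * r)).mul_left (poissonWeight (p * r) i)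
  rw [mul_one] at h
  refine (congrArg (HasSum · _) (funext fun n => ?_)).mp h
  have hexp : exp (-r) = exp (-(p * r)) * exp (-((1 - p) * r)) := by
    rw [← exp_add]; congr 1; ring
  have hchoose : ((n + i).choose i : ℝ) = (n + i)! / (i ! * n !) := by
    rw [add_comm, Nat.cast_add_choose]
  have hfact : ((n + i)! : ℝ) ≠ 0 := by positivity
  rw [thinning, hchoose, poissonWeight, poissonWeight, poissonWeight, hexp,
    Nat.add_sub_cancel, mul_pow, mul_pow, pow_add]
  field_simp

theorem sum_antidiagonal_poissonWeight_mul (r s : ℝ) (j : ℕ) :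
    ∑ q ∈ Finset.HasAntidiagonal.antidiagonal j, poissonWeight r q.1 * poissonWeight s q.2
      = poissonWeight (r + s) j := by
  rw [poissonWeight, (Commute.all r s).add_pow', Finset.mul_sum, Finset.sum_div]
  refine Finset.sum_congr rfl fun q hq => ?_
  obtain rfl : q.1 + q.2 = j := Finset.HasAntidiagonal.mem_antidiagonal.1 hq
  have hfact : ((q.1 + q.2)! : ℝ) ≠ 0 := by positivity
  rw [nsmul_eq_mul, Nat.cast_add_choose, neg_add, exp_add, poissonWeight, poissonWeight]
  field_simp

theorem hasSum_poissonWeight_mul_degradation (r p δ : ℝ) (j : ℕ) :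
    HasSum (fun k => poissonWeight r k * degradation p δ k j) (poissonWeight (p * r + δ) j) := by
  rw [← sum_antidiagonal_poissonWeight_mul]
  have h := hasSum_sum (s := Finset.HasAntidiagonal.antidiagonal j) fun q _ =>
    (hasSum_poissonWeight_mul_thinning r p q.1).mul_right (poissonWeight δ q.2)
  simpa only [degradation, Finset.mul_sum, mul_assoc] using h

theorem hasSum_sum_antidiagonal_mul {f g : ℕ → ℝ} {a b : ℝ} (hf : HasSum f a) (hg : HasSum g b) :
    HasSum (fun n => ∑ q ∈ Finset.HasAntidiagonal.antidiagonal n, f q.1 * g q.2) (a * b) := by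
  have hprod := summable_mul_of_summable_norm hf.summable.norm hg.summable.norm
  have h := hf.summable.tsum_mul_tsum_eq_tsum_sum_antidiagonal hg.summable hprod
  rw [hf.tsum_eq, hg.tsum_eq] at h
  exact h ▸ (summable_sum_mul_antidiagonal_of_summable_mul hprod).hasSum

namespace IsStrictDegradation

theorem degradation_term_nonneg (h : IsStrictDegradation p δ) (k : ℕ) (q : ℕ × ℕ) :
    0 ≤ thinning p k q.1 * poissonWeight δ q.2 := by
  have hp := h.pos
  have hδ := h.nonneg
  have hp' := sub_nonneg.2 h.le_one
  unfold thinning poissonWeight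
  positivity

theorem isStochastic (h : IsStrictDegradation p δ) : IsStochastic (degradation p δ) where
  nonneg k j := Finset.sum_nonneg fun q _ => h.degradation_term_nonneg k q
  hasSum_one k := by
    rw [← one_mul (1 : ℝ)]
    exact hasSum_sum_antidiagonal_mul (hasSum_thinning p k) (hasSum_poissonWeight δ)

theorem degradation_pos (h : IsStrictDegradation p δ) {k i n : ℕ}
    (hpos : 0 < thinning p k i * poissonWeight δ n) : 0 < degradation p δ k (i + n) :=
  Finset.sum_pos' (fun q _ => h.degradation_term_nonneg k q) ⟨(i, n), by simp, hpos⟩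

/-- With thinning the input `k` may be erased completely, without thinning it may be imitated by
`k` dark counts. -/
theorem exists_common_output (h : IsStrictDegradation p δ) (k : ℕ) :
    ∃ j, 0 < degradation p δ 0 j ∧ 0 < degradation p δ k j := by
  rcases h.strict with hp | hδ
  · have herase : ∀ n, 0 < thinning p n 0 * poissonWeight δ 0 := fun n => by
      rw [thinning_zero_right, poissonWeight_zero_right]
      exact mul_pos (pow_pos (sub_pos.2 hp) n) (exp_pos _)
    exact ⟨0 + 0, h.degradation_pos (herase 0), h.degradation_pos (herase k)⟩
  · have hkeep : ∀ n i, 0 < thinning p n n * poissonWeight δ i := fun n i => by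
      rw [thinning_self]
      exact mul_pos (pow_pos h.pos n) (poissonWeight_pos hδ i)
    exact ⟨0 + k, h.degradation_pos (hkeep 0 k), add_comm k 0 ▸ h.degradation_pos (hkeep k 0)⟩

end IsStrictDegradation

end Degradation

section DegradedOutput

variable {X : Type*} [MeasurableSpace X] {m : X → ℝ} {μ ν : Measure X} {l M p δ : ℝ}
  [IsProbabilityMeasure μ] [IsProbabilityMeasure ν]

theorem IsIntensity.hasSum_outputPMF_mul_degradation (hm : IsIntensity m μ l M)
    (h : IsStrictDegradation p δ) (j : ℕ) :
    HasSum (fun k => outputPMF m μ k * degradation p δ k j)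
      (outputPMF (fun x => p * m x + δ) μ j) := by
  have hW := h.isStochastic
  have hle : ∀ k, |degradation p δ k j| ≤ 1 * 1 ^ k := fun k => by
    rw [abs_of_nonneg (hW.nonneg k j), one_pow, one_mul]
    exact le_hasSum (hW.hasSum_one k) j fun i _ => hW.nonneg k i
  have hsum := hm.hasSum_outputPMF_mul ((PoissonSummable.const_mul_pow 1 1).of_abs_le hle)
  simp only [poissonAverage, (hasSum_poissonWeight_mul_degradation _ p δ j).tsum_eq] at hsum
  exact hsum

theorem IsIntensity.relEntropy_degraded_le (hμ : IsIntensity m μ l M) (hν : IsIntensity m ν l M)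
    (h : IsStrictDegradation p δ) :
    relEntropy (outputPMF (fun x => p * m x + δ) ν) (outputPMF (fun x => p * m x + δ) μ) ≤
      relEntropy (outputPMF m ν) (outputPMF m μ) :=
  have hμ' := hμ.mul_add h.pos h.nonneg
  have hν' := hν.mul_add h.pos h.nonneg
  h.isStochastic.relEntropy_le hν.isPositivePMF_outputPMF hμ.isPositivePMF_outputPMF
    hν'.isPositivePMF_outputPMF hμ'.isPositivePMF_outputPMF
    (hν.hasSum_outputPMF_mul_degradation h) (hμ.hasSum_outputPMF_mul_degradation h)
    (hμ.hasSum_relEntropy_outputPMF hν).summable (hμ'.hasSum_relEntropy_outputPMF hν').summable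

theorem IsIntensity.outputPMF_eq_of_relEntropy_degraded_eq (hμ : IsIntensity m μ l M)
    (hν : IsIntensity m ν l M) (h : IsStrictDegradation p δ)
    (heq : relEntropy (outputPMF (fun x => p * m x + δ) ν) (outputPMF (fun x => p * m x + δ) μ) =
      relEntropy (outputPMF m ν) (outputPMF m μ)) :
    outputPMF m ν = outputPMF m μ :=
  have hμ' := hμ.mul_add h.pos h.nonneg
  have hν' := hν.mul_add h.pos h.nonneg
  h.isStochastic.eq_of_relEntropy_eq hν.isPositivePMF_outputPMF hμ.isPositivePMF_outputPMF
    hν'.isPositivePMF_outputPMF hμ'.isPositivePMF_outputPMF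
    (hν.hasSum_outputPMF_mul_degradation h) (hμ.hasSum_outputPMF_mul_degradation h)
    (hμ.hasSum_relEntropy_outputPMF hν).summable (hμ'.hasSum_relEntropy_outputPMF hν').summable
    heq h.exists_common_output

end DegradedOutput

/-! ### Identifiability of the mixing law -/

section Identifiability

variable {X : Type*} [MeasurableSpace X] {m : X → ℝ} {μ ν : Measure X} {l M : ℝ}
  [IsProbabilityMeasure μ] [IsProbabilityMeasure ν]

theorem map_eq_of_mgf_eq (hm : Measurable m) (hint : ∀ t, Integrable (fun x => exp (t * m x)) μ)
    (h : mgf m μ = mgf m ν) : μ.map m = ν.map m := by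
  have hset : integrableExpSet m μ = univ := eq_univ_of_forall hint
  have hmgf := eqOn_complexMGF_of_mgf h
  simp only [hset, interior_univ, mem_univ] at hmgf
  exact Measure.ext_of_complexMGF_eq hm.aemeasurable hm.aemeasurable
    (funext fun z => hmgf (mem_univ z))

theorem IsIntensity.mgf_eq_tsum (hm : IsIntensity m μ l M) (t : ℝ) :
    mgf m μ t = ∑' k, outputPMF m μ k * (1 + t) ^ k := by
  have hf : PoissonSummable fun k => (1 + t) ^ k := by
    simpa only [one_mul] using PoissonSummable.const_mul_pow 1 (1 + t)
  simp only [(hm.hasSum_outputPMF_mul hf).tsum_eq, poissonAverage_pow, mgf]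

theorem IsIntensity.map_eq_of_outputPMF_eq (hμ : IsIntensity m μ l M) (hν : IsIntensity m ν l M)
    (h : outputPMF m μ = outputPMF m ν) : μ.map m = ν.map m :=
  map_eq_of_mgf_eq hμ.measurable
    (fun t => hμ.integrable_comp (g := fun r => exp (t * r)) (by fun_prop))
    (funext fun t => by rw [hμ.mgf_eq_tsum, hν.mgf_eq_tsum, h])

theorem IsIntensity.eq_of_outputPMF_eq (hμ : IsIntensity m μ l M) (hν : IsIntensity m ν l M)
    (hm : MeasurableEmbedding m) (h : outputPMF m μ = outputPMF m ν) : μ = ν := by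
  rw [← hm.comap_map μ, hμ.map_eq_of_outputPMF_eq hν h, hm.comap_map]

end Identifiability

/-! ### Mutual information across a Poisson channel -/

section MutualInformation

variable {X : Type*} [MeasurableSpace X] {m : X → ℝ} {μ : Measure X} {κ : Kernel X ℕ} {l M r : ℝ}

theorem poissonMeasure_toNNReal_singleton (hr : 0 ≤ r) (k : ℕ) :
    poissonMeasure r.toNNReal {k} = ENNReal.ofReal (poissonWeight r k) := by
  rw [poissonMeasure_singleton, Real.coe_toNNReal _ hr, poissonWeight]

theorem integral_poissonMeasure_toNNReal (hr : 0 ≤ r) (f : ℕ → ℝ) :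
    ∫ k, f k ∂poissonMeasure r.toNNReal = poissonAverage f r := by
  simp only [integral_poissonMeasure, Real.coe_toNNReal _ hr, smul_eq_mul, poissonAverage,
    poissonWeight]

theorem PoissonSummable.integrable {f : ℕ → ℝ} (hf : PoissonSummable f) (hr : 0 ≤ r) :
    Integrable f (poissonMeasure r.toNNReal) := by
  rw [integrable_poissonMeasure_iff, Real.coe_toNNReal _ hr]
  exact hf.abs.summable r

/-- The logarithm of the likelihood ratio between the output `z.2` given the input `z.1` and the
output law. -/
noncomputable def logLikelihood (m : X → ℝ) (μ : Measure X) (z : X × ℕ) : ℝ :=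
  log (poissonWeight (m z.1) z.2 / outputPMF m μ z.2)

namespace IsIntensity

theorem measurable_likelihoodRatio (hm : IsIntensity m μ l M) :
    Measurable fun z : X × ℕ => poissonWeight (m z.1) z.2 / outputPMF m μ z.2 := by
  have hweight : Measurable fun q : ℝ × ℕ => poissonWeight q.1 q.2 :=
    measurable_from_prod_countable_left fun k => (continuous_poissonWeight k).measurable
  exact (hweight.comp (hm.measurable.prodMap measurable_id)).div
    ((measurable_of_countable (outputPMF m μ)).comp measurable_snd)

theorem measurable_logLikelihood (hm : IsIntensity m μ l M) : Measurable (logLikelihood m μ) :=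
  hm.measurable_likelihoodRatio.log

variable [IsProbabilityMeasure μ]

theorem logLikelihood_eq (hm : IsIntensity m μ l M) {x : X} (hx : 0 < m x) (k : ℕ) :
    logLikelihood m μ (x, k) = -m x + k * log (m x) - logOutput m μ k := by
  have hP := hm.outputPMF_pos k
  rw [logLikelihood, poissonWeight, logOutput, log_div (by positivity) hP.ne',
    log_div (by positivity) (by positivity), log_mul (by positivity) (by positivity),
    log_mul (by positivity) hP.ne', log_exp, log_pow]
  ring

theorem poissonAverage_logLikelihood (hm : IsIntensity m μ l M) {x : X} (hx : 0 < m x) :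
    poissonAverage (fun k => logLikelihood m μ (x, k)) (m x) = infoDensity m μ (m x) := by
  have h := (((hasSum_poissonWeight (m x)).mul_right (-m x)).add
    ((hasSum_poissonWeight_mul_natCast (m x)).mul_right (log (m x)))).sub
    (hm.poissonSummable_logOutput.summable (m x)).hasSum
  refine Eq.trans (tsum_congr fun k => ?_) (h.tsum_eq.trans ?_)
  · beta_reduce
    rw [hm.logLikelihood_eq hx]
    ring
  · rw [infoDensity, poissonAverage]; ring

theorem abs_logLikelihood_le (hm : IsIntensity m μ l M) {x : X} (hx : m x ∈ Icc l M) (k : ℕ) :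
    |logLikelihood m μ (x, k)| ≤ 2 * M + 2 * (|log l| + |log M|) * k := by
  have hpos := hm.pos.trans_le hx.1
  have hlog : |log (m x)| ≤ |log l| + |log M| :=
    (abs_le_max_abs_abs (log_le_log hm.pos hx.1) (log_le_log hpos hx.2)).trans
      (max_le_add_of_nonneg (abs_nonneg _) (abs_nonneg _))
  rw [hm.logLikelihood_eq hpos]
  calc |-m x + k * log (m x) - logOutput m μ k|
      ≤ |-m x| + |k * log (m x)| + |logOutput m μ k| :=
        (abs_sub _ _).trans (add_le_add_left (abs_add_le _ _) _)
    _ ≤ M + k * (|log l| + |log M|) + (M + (|log l| + |log M|) * k) := by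
        rw [abs_neg, abs_of_pos hpos, abs_mul, Nat.abs_cast]
        gcongr
        exacts [hx.2, hm.abs_logOutput_le k]
    _ = 2 * M + 2 * (|log l| + |log M|) * k := by ring

theorem comp_singleton (hm : IsIntensity m μ l M)
    (hκ : ∀ x, κ x = poissonMeasure (m x).toNNReal) (k : ℕ) :
    (κ ∘ₘ μ) {k} = ENNReal.ofReal (outputPMF m μ k) := by
  rw [Measure.bind_apply (MeasurableSet.of_discrete) κ.aemeasurable, outputPMF,
    ofReal_integral_eq_lintegral_ofReal (hm.integrable_poissonWeight k)
      (hm.ae_pos.mono fun x hx => poissonWeight_nonneg hx.le k)]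
  exact lintegral_congr_ae <| hm.ae_pos.mono fun x hx => by
    simp only [hκ, poissonMeasure_toNNReal_singleton hx.le]

theorem compProd_eq_withDensity [IsMarkovKernel κ] (hm : IsIntensity m μ l M)
    (hκ : ∀ x, κ x = poissonMeasure (m x).toNNReal) :
    μ ⊗ₘ κ = (μ.prod (κ ∘ₘ μ)).withDensity fun z =>
      ENNReal.ofReal (poissonWeight (m z.1) z.2 / outputPMF m μ z.2) := by
  have hmeas := hm.measurable_likelihoodRatio.ennreal_ofReal
  ext s hs
  rw [Measure.compProd_apply hs, withDensity_apply _ hs, ← lintegral_indicator hs,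
    lintegral_prod _ (hmeas.indicator hs).aemeasurable]
  refine lintegral_congr_ae (hm.ae_pos.mono fun x hx => ?_)
  simp only
  rw [lintegral_countable', ← Measure.tsum_indicator_apply_singleton _ _ (.of_discrete)]
  refine tsum_congr fun k => ?_
  have hP := hm.outputPMF_pos k
  rw [hm.comp_singleton hκ]
  by_cases hk : (x, k) ∈ s
  · rw [indicator_of_mem (show k ∈ Prod.mk x ⁻¹' s from hk), indicator_of_mem hk, hκ,
      poissonMeasure_toNNReal_singleton hx.le,
      ← ENNReal.ofReal_mul (div_nonneg (poissonWeight_nonneg hx.le k) hP.le),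
      div_mul_cancel₀ _ hP.ne']
  · rw [indicator_of_notMem (show k ∉ Prod.mk x ⁻¹' s from hk), indicator_of_notMem hk, zero_mul]

theorem llr_ae_eq_logLikelihood [IsMarkovKernel κ] (hm : IsIntensity m μ l M)
    (hκ : ∀ x, κ x = poissonMeasure (m x).toNNReal) :
    llr (μ ⊗ₘ κ) (μ.prod (κ ∘ₘ μ)) =ᵐ[μ ⊗ₘ κ] logLikelihood m μ := by
  have hdens := hm.compProd_eq_withDensity hκ
  have hac : μ ⊗ₘ κ ≪ μ.prod (κ ∘ₘ μ) := hdens ▸ withDensity_absolutelyContinuous _ _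
  have hderiv : (μ ⊗ₘ κ).rnDeriv (μ.prod (κ ∘ₘ μ)) =ᵐ[μ.prod (κ ∘ₘ μ)] fun z =>
      ENNReal.ofReal (poissonWeight (m z.1) z.2 / outputPMF m μ z.2) := by
    conv_lhs => rw [hdens]
    exact Measure.rnDeriv_withDensity _ hm.measurable_likelihoodRatio.ennreal_ofReal
  have hpos : ∀ᵐ z ∂(μ ⊗ₘ κ), 0 < m z.1 := by
    have hset : MeasurableSet {z : X × ℕ | 0 < m z.1} :=
      (hm.measurable.comp measurable_fst) measurableSet_Ioi
    rw [Measure.ae_compProd_iff hset]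
    exact hm.ae_pos.mono fun x hx => .of_forall fun _ => hx
  filter_upwards [hac.ae_le hderiv, hpos] with z hz hz_pos
  rw [llr, hz, ENNReal.toReal_ofReal
    (div_pos (poissonWeight_pos hz_pos _) (hm.outputPMF_pos _)).le, logLikelihood]

theorem poissonSummable_logLikelihood (hm : IsIntensity m μ l M) {x : X} (hx : m x ∈ Icc l M) :
    PoissonSummable fun k => logLikelihood m μ (x, k) :=
  have hM := hm.upper_pos
  .of_abs_le_linear (by positivity) (by positivity) (hm.abs_logLikelihood_le hx)

theorem integrable_logLikelihood [IsMarkovKernel κ] (hm : IsIntensity m μ l M)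
    (hκ : ∀ x, κ x = poissonMeasure (m x).toNNReal) :
    Integrable (logLikelihood m μ) (μ ⊗ₘ κ) := by
  have hmeas := hm.measurable_logLikelihood
  set a := 2 * M
  set b := 2 * (|log l| + |log M|)
  have hbound : ∀ᵐ x ∂μ, ∫ k, ‖logLikelihood m μ (x, k)‖ ∂κ x ≤ a + b * m x := by
    filter_upwards [hm.ae_mem] with x hx
    have hpos := hm.pos.trans_le hx.1
    have hlinear := ((hasSum_poissonWeight (m x)).mul_right a).add
      ((hasSum_poissonWeight_mul_natCast (m x)).mul_left b)
    rw [hκ, integral_poissonMeasure_toNNReal hpos.le, ← one_mul a]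
    refine hasSum_le (fun k => ?_)
      ((hm.poissonSummable_logLikelihood hx).abs.summable (m x)).hasSum hlinear
    calc poissonWeight (m x) k * |logLikelihood m μ (x, k)|
        ≤ poissonWeight (m x) k * (a + b * k) :=
          mul_le_mul_of_nonneg_left (hm.abs_logLikelihood_le hx k) (poissonWeight_nonneg hpos.le k)
      _ = poissonWeight (m x) k * a + b * (poissonWeight (m x) k * k) := by ring
  rw [Measure.integrable_compProd_iff hmeas.aestronglyMeasurable]
  refine ⟨hm.ae_mem.mono fun x hx => ?_, ?_⟩
  · rw [hκ]
    exact (hm.poissonSummable_logLikelihood hx).integrable (hm.pos.le.trans hx.1)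
  · refine (hm.integrable_comp (g := fun r => a + b * r) (by fun_prop)).mono'
      hmeas.norm.stronglyMeasurable.integral_kernel_prod_right'.aestronglyMeasurable ?_
    refine hbound.mono fun x hx => ?_
    rwa [norm_of_nonneg (integral_nonneg fun _ => norm_nonneg _)]

theorem mutualInfo_ne_top [IsMarkovKernel κ] (hm : IsIntensity m μ l M)
    (hκ : ∀ x, κ x = poissonMeasure (m x).toNNReal) : mutualInfo μ κ ≠ ∞ :=
  klDiv_ne_top (hm.compProd_eq_withDensity hκ ▸ withDensity_absolutelyContinuous _ _)
    ((integrable_congr (hm.llr_ae_eq_logLikelihood hκ)).2 (hm.integrable_logLikelihood hκ))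

theorem toReal_mutualInfo [IsMarkovKernel κ] (hm : IsIntensity m μ l M)
    (hκ : ∀ x, κ x = poissonMeasure (m x).toNNReal) : (mutualInfo μ κ).toReal = infoRate m μ := by
  rw [mutualInfo, toReal_klDiv_of_measure_eq
      (hm.compProd_eq_withDensity hκ ▸ withDensity_absolutelyContinuous _ _) (by simp),
    integral_congr_ae (hm.llr_ae_eq_logLikelihood hκ),
    Measure.integral_compProd (hm.integrable_logLikelihood hκ), infoRate]
  exact integral_congr_ae <| hm.ae_pos.mono fun x hx => by
    simp only [hκ]
    rw [integral_poissonMeasure_toNNReal hx.le, hm.poissonAverage_logLikelihood hx]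

end IsIntensity

end MutualInformation

/-! ### Weak compactness and continuity -/

section Compactness

variable {X : Type*} [TopologicalSpace X] [T2Space X] [MeasurableSpace X]
  [BorelSpace X] {K : Set X} {m : X → ℝ} {l M : ℝ}

theorem isCompact_setOf_measure_eq_one (hK : IsCompact K) :
    IsCompact {μ : ProbabilityMeasure X | (μ : Measure X) K = 1} := by
  have h := isCompact_setOfPred_probabilityMeasure_mass_eq_compl_isCompact_le (E := X)
    (u := fun _ => 0) (K := fun _ => K) tendsto_const_nhds (fun _ => hK) (Or.inr monotone_const)
  refine (congrArg IsCompact (ext fun μ => ?_)).mp h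
  simp only [mem_ofPred_eq, nonpos_iff_eq_zero, forall_const]
  rw [← prob_compl_eq_zero_iff hK.measurableSet, ← ENNReal.coe_eq_zero,
    ProbabilityMeasure.ennreal_coeFn_eq_coeFn_toMeasure]

variable [NormalSpace X]

theorem continuousOn_integral (hK : IsCompact K) {g : X → ℝ} (hg : ContinuousOn g K) :
    ContinuousOn (fun μ : ProbabilityMeasure X => ∫ x, g x ∂(μ : Measure X))
      {μ | (μ : Measure X) K = 1} := by
  have : CompactSpace K := isCompact_iff_compactSpace.1 hK
  obtain ⟨G, -, hG⟩ := BoundedContinuousFunction.exists_extension_norm_eq_of_isClosedEmbedding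
    (.mkOfCompact ⟨K.domRestrict g, continuousOn_iff_continuous_domRestrict.1 hg⟩)
    hK.isClosed.isClosedEmbedding_subtypeVal
  have hcont : Continuous fun μ : ProbabilityMeasure X => ∫ x, G x ∂(μ : Measure X) :=
    continuous_iff_continuousAt.2 fun μ =>
      ProbabilityMeasure.tendsto_iff_forall_integral_tendsto.1 tendsto_id G
  refine hcont.continuousOn.congr fun μ hμ => integral_congr_ae ?_
  filter_upwards [(mem_ae_iff_prob_eq_one hK.measurableSet).2 hμ] with x hx
  exact (congrFun hG ⟨x, hx⟩).symm

theorem continuousOn_infoRate (hK : IsCompact K) (hm : Measurable m) (hmc : ContinuousOn m K)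
    (hl : 0 < l) (hmaps : MapsTo m K (Icc l M)) :
    ContinuousOn (fun μ : ProbabilityMeasure X => infoRate m (μ : Measure X))
      {μ | (μ : Measure X) K = 1} := by
  have hint : ∀ μ ∈ {μ : ProbabilityMeasure X | (μ : Measure X) K = 1},
      IsIntensity m (μ : Measure X) l M := fun μ hμ =>
    ⟨hm, hl, Filter.mem_of_superset ((mem_ae_iff_prob_eq_one hK.measurableSet).2 hμ) hmaps⟩
  have hrate : ContinuousOn (fun μ : ProbabilityMeasure X =>
      ∫ x, (m x * log (m x) - m x) ∂(μ : Measure X) -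
        ∑' k, outputPMF m μ k * logOutput m μ k) {μ | (μ : Measure X) K = 1} := by
    refine (continuousOn_integral hK ((continuous_mul_log.comp_continuousOn hmc).sub hmc)).sub ?_
    refine continuousOn_tsum (fun k => ?_)
      (PoissonSummable.const_add_mul_natCast M (|log l| + |log M|) M) fun k μ hμ => ?_
    · have hout : ContinuousOn (fun μ : ProbabilityMeasure X => outputPMF m (μ : Measure X) k)
          {μ | (μ : Measure X) K = 1} :=
        continuousOn_integral hK ((continuous_poissonWeight k).comp_continuousOn hmc)
      refine hout.mul ((continuousOn_const.mul hout).log fun μ hμ => ?_)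
      exact mul_ne_zero (by positivity) ((hint μ hμ).outputPMF_pos k).ne'
    · have hpos := (hint μ hμ).outputPMF_pos k
      have hle := (hint μ hμ).outputPMF_le k
      rw [norm_mul, norm_of_nonneg hpos.le]
      exact mul_le_mul hle ((hint μ hμ).abs_logOutput_le k) (norm_nonneg _) (hpos.le.trans hle)
  exact hrate.congr fun μ hμ => (hint μ hμ).integral_infoDensity_eq_sub_tsum (hint μ hμ)

end Compactness

/-! ### The secrecy rate and its strict concavity -/

/-- The secrecy rate when the eavesdropper's intensity is the degradation `p * m + δ` of the
intensity `m` of the legitimate receiver. -/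
noncomputable def degradedRate {X : Type*} [MeasurableSpace X] (m : X → ℝ) (p δ : ℝ)
    (μ : Measure X) : ℝ :=
  infoRate m μ - infoRate (fun x => p * m x + δ) μ

/-- The function of the intensity `r` whose mean over the inputs is the secrecy rate; it is the
derivative of the secrecy rate at `μ`. -/
noncomputable def degradedDensity {X : Type*} [MeasurableSpace X] (m : X → ℝ) (p δ : ℝ)
    (μ : Measure X) (r : ℝ) : ℝ :=
  infoDensity m μ r - infoDensity (fun x => p * m x + δ) μ (p * r + δ)

/-- The mixture of two laws with equal weights. -/
noncomputable def midpointMeasure {X : Type*} [MeasurableSpace X] (μ ν : Measure X) : Measure X :=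
  (2⁻¹ : ℝ≥0∞) • μ + (2⁻¹ : ℝ≥0∞) • ν

section SecrecyRate

variable {X : Type*} [MeasurableSpace X] {m : X → ℝ} {μ ν : Measure X} {l M p δ : ℝ}

theorem ae_midpointMeasure {P : X → Prop} (hμ : ∀ᵐ x ∂μ, P x) (hν : ∀ᵐ x ∂ν, P x) :
    ∀ᵐ x ∂midpointMeasure μ ν, P x := by
  rw [midpointMeasure, ae_add_measure_iff]
  exact ⟨Measure.ae_smul_measure hμ _, Measure.ae_smul_measure hν _⟩

theorem integral_midpointMeasure {g : X → ℝ} (hμ : Integrable g μ) (hν : Integrable g ν) :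
    ∫ x, g x ∂midpointMeasure μ ν = (∫ x, g x ∂μ + ∫ x, g x ∂ν) / 2 := by
  rw [midpointMeasure,
    integral_add_measure (hμ.smul_measure (by simp)) (hν.smul_measure (by simp)),
    integral_smul_measure, integral_smul_measure]
  simp only [ENNReal.toReal_inv, ENNReal.toReal_ofNat, smul_eq_mul]
  ring

theorem IsIntensity.midpoint (hμ : IsIntensity m μ l M) (hν : IsIntensity m ν l M) :
    IsIntensity m (midpointMeasure μ ν) l M :=
  ⟨hμ.measurable, hμ.pos, ae_midpointMeasure hμ.ae_mem hν.ae_mem⟩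

variable [IsProbabilityMeasure μ] [IsProbabilityMeasure ν]

instance : IsProbabilityMeasure (midpointMeasure μ ν) :=
  ⟨by simp [midpointMeasure, ENNReal.inv_two_add_inv_two]⟩

namespace IsIntensity

theorem continuous_degradedDensity (hm : IsIntensity m μ l M) (h : IsStrictDegradation p δ) :
    Continuous (degradedDensity m p δ μ) :=
  hm.continuous_infoDensity.sub
    ((hm.mul_add h.pos h.nonneg).continuous_infoDensity.comp (by fun_prop))

theorem integrable_degradedDensity (hμ : IsIntensity m μ l M) (hν : IsIntensity m ν l M)
    (h : IsStrictDegradation p δ) : Integrable (fun x => degradedDensity m p δ μ (m x)) ν :=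
  hν.integrable_comp (hμ.continuous_degradedDensity h).continuousOn

theorem integral_degradedDensity (hμ : IsIntensity m μ l M) (hν : IsIntensity m ν l M)
    (h : IsStrictDegradation p δ) :
    ∫ x, degradedDensity m p δ μ (m x) ∂ν = degradedRate m p δ ν +
      (relEntropy (outputPMF m ν) (outputPMF m μ) -
        relEntropy (outputPMF (fun x => p * m x + δ) ν) (outputPMF (fun x => p * m x + δ) μ)) := by
  have hμ' := hμ.mul_add h.pos h.nonneg
  have hν' := hν.mul_add h.pos h.nonneg
  calc ∫ x, degradedDensity m p δ μ (m x) ∂ν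
      = ∫ x, infoDensity m μ (m x) ∂ν -
          ∫ x, infoDensity (fun x => p * m x + δ) μ (p * m x + δ) ∂ν :=
        integral_sub (hμ.integrable_infoDensity hν) (hμ'.integrable_infoDensity hν')
    _ = _ := by
        rw [hμ.integral_infoDensity hν, hμ'.integral_infoDensity hν', degradedRate]
        ring

theorem integral_degradedDensity_self (hm : IsIntensity m μ l M) (h : IsStrictDegradation p δ) :
    ∫ x, degradedDensity m p δ μ (m x) ∂μ = degradedRate m p δ μ := by
  rw [hm.integral_degradedDensity hm h, relEntropy_self, relEntropy_self, sub_zero, add_zero]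

theorem degradedRate_le_integral (hμ : IsIntensity m μ l M) (hν : IsIntensity m ν l M)
    (h : IsStrictDegradation p δ) :
    degradedRate m p δ ν ≤ ∫ x, degradedDensity m p δ μ (m x) ∂ν := by
  rw [hμ.integral_degradedDensity hν h]
  exact le_add_of_nonneg_right (sub_nonneg.2 (hμ.relEntropy_degraded_le hν h))

theorem outputPMF_eq_of_degradedRate_eq_integral (hμ : IsIntensity m μ l M)
    (hν : IsIntensity m ν l M) (h : IsStrictDegradation p δ)
    (heq : degradedRate m p δ ν = ∫ x, degradedDensity m p δ μ (m x) ∂ν) :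
    outputPMF m ν = outputPMF m μ := by
  rw [hμ.integral_degradedDensity hν h, left_eq_add, sub_eq_zero] at heq
  exact hμ.outputPMF_eq_of_relEntropy_degraded_eq hν h heq.symm

theorem degradedRate_midpoint_lt (hμ : IsIntensity m μ l M) (hν : IsIntensity m ν l M)
    (h : IsStrictDegradation p δ) (hm : MeasurableEmbedding m) (hne : μ ≠ ν) :
    (degradedRate m p δ μ + degradedRate m p δ ν) / 2 <
      degradedRate m p δ (midpointMeasure μ ν) := by
  have hρ := hμ.midpoint hν
  have hle_μ := hρ.degradedRate_le_integral hμ h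
  have hle_ν := hρ.degradedRate_le_integral hν h
  rw [← hρ.integral_degradedDensity_self h, integral_midpointMeasure
    (hρ.integrable_degradedDensity hμ h) (hρ.integrable_degradedDensity hν h)]
  by_contra! hge
  have heq_μ := hρ.outputPMF_eq_of_degradedRate_eq_integral hμ h (by linarith)
  have heq_ν := hρ.outputPMF_eq_of_degradedRate_eq_integral hν h (by linarith)
  exact hne (hμ.eq_of_outputPMF_eq hν hm (heq_μ.trans heq_ν.symm))

end IsIntensity

end SecrecyRate

/-! ### First order optimality -/

section Regression

variable {X : Type*} [MeasurableSpace X] {μ : Measure X} [IsProbabilityMeasure μ] {f c : X → ℝ}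

theorem ae_eq_integral_of_variance_eq_zero (hf : MemLp f 2 μ) (h : Var[f; μ] = 0) :
    f =ᵐ[μ] fun _ => μ[f] := by
  rw [← evariance_eq_zero_iff hf.aemeasurable, ← hf.ofReal_variance_eq, h, ENNReal.ofReal_zero]

theorem covariance_eq_integral_sub_mul (hf : MemLp f 2 μ) (hc : MemLp c 2 μ) :
    cov[f, c; μ] = ∫ x, (f x - μ[f]) * c x ∂μ := by
  have hfc : Integrable (fun x => f x * c x) μ := hf.integrable_mul hc
  simp only [sub_mul]
  rw [integral_sub hfc ((hc.integrable one_le_two).const_mul _), integral_const_mul]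
  exact covariance_eq_sub hf hc

theorem exists_covariance_sub_mul_eq_zero (hf : MemLp f 2 μ) (hc : MemLp c 2 μ) :
    ∃ s : ℝ, cov[fun x => c x - s * f x, f; μ] = 0 := by
  have hcov : ∀ s : ℝ, cov[fun x => c x - s * f x, f; μ] = cov[c, f; μ] - s * Var[f; μ] :=
    fun s => by
      rw [covariance_fun_sub_left hc (hf.const_mul s) hf, covariance_const_mul_left,
        covariance_self hf.aemeasurable]
  by_cases hvar : Var[f; μ] = 0
  · refine ⟨0, ?_⟩
    have hconst := ae_eq_integral_of_variance_eq_zero hf hvar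
    rw [hcov, zero_mul, sub_zero, covariance]
    exact integral_eq_zero_of_ae (hconst.mono fun x hx => by simp [hx])
  · exact ⟨cov[c, f; μ] / Var[f; μ], by rw [hcov, div_mul_cancel₀ _ hvar, sub_self]⟩

theorem ae_eq_const_of_covariance_eq_zero {s : ℝ} (hf : MemLp f 2 μ) (hc : MemLp c 2 μ)
    (hres_f : cov[fun x => c x - s * f x, f; μ] = 0)
    (hres_c : cov[fun x => c x - s * f x, c; μ] = 0) :
    ∀ᵐ x ∂μ, c x - s * f x = ∫ x, (c x - s * f x) ∂μ := by
  have hres : MemLp (fun x => c x - s * f x) 2 μ := hc.sub (hf.const_mul s)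
  refine ae_eq_integral_of_variance_eq_zero hres ?_
  rw [← covariance_self hres.aemeasurable]
  refine (covariance_fun_sub_right hres hc (hf.const_mul s)).trans ?_
  rw [covariance_const_mul_right]
  exact hres_c.symm ▸ hres_f.symm ▸ by simp

end Regression

theorem eq_zero_of_eventually_mul_le_sq {I C : ℝ} (h : ∀ᶠ t in 𝓝 (0 : ℝ), t * I ≤ C * t ^ 2) :
    I = 0 := by
  have hmin : IsLocalMin (fun t : ℝ => C * t ^ 2 - t * I) 0 := by
    filter_upwards [h] with t ht
    linarith
  have hderiv : HasDerivAt (fun t : ℝ => C * t ^ 2 - t * I) (-I) 0 := by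
    simpa using ((hasDerivAt_pow 2 (0 : ℝ)).const_mul C).fun_sub ((hasDerivAt_id' 0).mul_const I)
  exact neg_eq_zero.1 (hmin.hasDerivAt_eq_zero hderiv)

/-- The perturbation of `μ` in the direction `h`, with density `1 + t * h` relative to `μ`. -/
noncomputable def linearTilt {X : Type*} [MeasurableSpace X] (μ : Measure X) (h : X → ℝ) (t : ℝ) :
    Measure X :=
  μ.withDensity fun x => ENNReal.ofReal (1 + t * h x)

section LinearTilt

variable {X : Type*} [MeasurableSpace X] {μ : Measure X} {h : X → ℝ} {t H : ℝ}

theorem ae_one_add_mul_nonneg (hH : ∀ᵐ x ∂μ, |h x| ≤ H) (ht : |t| * H ≤ 1) :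
    ∀ᵐ x ∂μ, 0 ≤ 1 + t * h x := by
  filter_upwards [hH] with x hx
  have hle : |t * h x| ≤ 1 :=
    calc |t * h x| = |t| * |h x| := abs_mul _ _
      _ ≤ |t| * H := by gcongr
      _ ≤ 1 := ht
  linarith [neg_abs_le (t * h x)]

theorem integral_linearTilt (hh : Measurable h) (hH : ∀ᵐ x ∂μ, |h x| ≤ H) (ht : |t| * H ≤ 1)
    {g : X → ℝ} (hg : Integrable g μ) :
    ∫ x, g x ∂linearTilt μ h t = ∫ x, g x ∂μ + t * ∫ x, h x * g x ∂μ := by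
  have hhg : Integrable (fun x => h x * g x) μ := hg.bdd_mul hh.aestronglyMeasurable hH
  rw [linearTilt, integral_withDensity_eq_integral_toReal_smul (by fun_prop)
    (.of_forall fun _ => ENNReal.ofReal_lt_top), ← integral_const_mul,
    ← integral_add hg (hhg.const_mul t)]
  refine integral_congr_ae ((ae_one_add_mul_nonneg hH ht).mono fun x hx => ?_)
  simp only [ENNReal.toReal_ofReal hx, smul_eq_mul]
  ring

theorem isProbabilityMeasure_linearTilt [IsProbabilityMeasure μ] (hh : Measurable h)
    (hH : ∀ᵐ x ∂μ, |h x| ≤ H) (h0 : ∫ x, h x ∂μ = 0) (ht : |t| * H ≤ 1) :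
    IsProbabilityMeasure (linearTilt μ h t) := by
  have hint : Integrable h μ := .of_bound hh.aestronglyMeasurable H hH
  have hdens : Integrable (fun x => 1 + t * h x) μ := (integrable_const 1).add (hint.const_mul t)
  refine ⟨?_⟩
  rw [linearTilt, withDensity_apply _ .univ, setLIntegral_univ,
    ← ofReal_integral_eq_lintegral_ofReal hdens
      (ae_one_add_mul_nonneg hH ht),
    integral_add (integrable_const 1) (hint.const_mul t), integral_const_mul, h0]
  simp

theorem linearTilt_absolutelyContinuous : linearTilt μ h t ≪ μ :=
  withDensity_absolutelyContinuous _ _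

variable {m : X → ℝ} {l M : ℝ} [IsProbabilityMeasure μ]

theorem IsIntensity.abs_outputPMF_linearTilt_sub_le (hm : IsIntensity m μ l M) (hh : Measurable h)
    (hH : ∀ᵐ x ∂μ, |h x| ≤ H) (ht : |t| * H ≤ 1) (k : ℕ) :
    |outputPMF m (linearTilt μ h t) k - outputPMF m μ k| ≤ |t| * H * outputPMF m μ k := by
  have hint := hm.integrable_poissonWeight k
  rw [outputPMF, integral_linearTilt hh hH ht hint, ← outputPMF, add_sub_cancel_left, abs_mul,
    mul_assoc]
  gcongr
  rw [outputPMF, ← integral_const_mul]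
  refine abs_integral_le_integral_abs.trans (integral_mono_ae
    (hint.bdd_mul hh.aestronglyMeasurable hH).abs (hint.const_mul H) ?_)
  filter_upwards [hH, hm.ae_pos] with x hx hpos
  rw [abs_mul, abs_of_nonneg (poissonWeight_nonneg hpos.le k)]
  exact mul_le_mul_of_nonneg_right hx (poissonWeight_nonneg hpos.le k)

end LinearTilt

/-- The law `μ` maximizes the secrecy rate among the absolutely continuous laws with the same mean
intensity. Only such local competitors are needed to find the density of an optimal law. -/
def IsLocallyOptimal {X : Type*} [MeasurableSpace X] (m : X → ℝ) (p δ : ℝ) (μ : Measure X) : Prop :=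
  ∀ ν : Measure X, IsProbabilityMeasure ν → ν ≪ μ → ∫ x, m x ∂ν = ∫ x, m x ∂μ →
    degradedRate m p δ ν ≤ degradedRate m p δ μ

section Optimality

variable {X : Type*} [MeasurableSpace X] {m h : X → ℝ} {μ ν : Measure X} {l M p δ t H : ℝ}
  [IsProbabilityMeasure μ]

namespace IsIntensity

theorem integral_degradedDensity_le [IsProbabilityMeasure ν] (hμ : IsIntensity m μ l M)
    (hν : IsIntensity m ν l M) (hd : IsStrictDegradation p δ) :
    ∫ x, degradedDensity m p δ μ (m x) ∂ν ≤
      degradedRate m p δ ν + relEntropy (outputPMF m ν) (outputPMF m μ) := by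
  have hμ' := hμ.mul_add hd.pos hd.nonneg
  have hν' := hν.mul_add hd.pos hd.nonneg
  rw [hμ.integral_degradedDensity hν hd]
  exact add_le_add_right (sub_le_self _ (hν'.isPositivePMF_outputPMF.relEntropy_nonneg
    hμ'.isPositivePMF_outputPMF (hμ'.hasSum_relEntropy_outputPMF hν').summable)) _

theorem mul_integral_degradedDensity_le (hm : IsIntensity m μ l M) (hd : IsStrictDegradation p δ)
    (hopt : IsLocallyOptimal m p δ μ) (hh : Measurable h) (hH : ∀ᵐ x ∂μ, |h x| ≤ H)
    (h0 : ∫ x, h x ∂μ = 0) (h1 : ∫ x, h x * m x ∂μ = 0) (ht : |t| * H ≤ 1) :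
    t * ∫ x, h x * degradedDensity m p δ μ (m x) ∂μ ≤ H ^ 2 * t ^ 2 := by
  have hprob := isProbabilityMeasure_linearTilt hh hH h0 ht
  have htilt := hm.of_absolutelyContinuous (linearTilt_absolutelyContinuous (h := h) (t := t))
  have hmean : ∫ x, m x ∂linearTilt μ h t = ∫ x, m x ∂μ := by
    rw [integral_linearTilt hh hH ht (hm.integrable_comp (g := fun r => r) (by fun_prop)), h1,
      mul_zero, add_zero]
  have hle := hopt _ hprob linearTilt_absolutelyContinuous hmean
  have hlower := hm.integral_degradedDensity_le htilt hd
  rw [integral_linearTilt hh hH ht (hm.integrable_degradedDensity hm hd),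
    hm.integral_degradedDensity_self hd] at hlower
  have hentropy := htilt.isPositivePMF_outputPMF.relEntropy_le_sq hm.isPositivePMF_outputPMF
    (hm.hasSum_relEntropy_outputPMF htilt).summable
    (hm.abs_outputPMF_linearTilt_sub_le hh hH ht)
  rw [mul_pow, sq_abs] at hentropy
  linarith

theorem integral_mul_degradedDensity_eq_zero (hm : IsIntensity m μ l M)
    (hd : IsStrictDegradation p δ) (hopt : IsLocallyOptimal m p δ μ) (hh : Measurable h)
    (hH : ∀ᵐ x ∂μ, |h x| ≤ H) (h0 : ∫ x, h x ∂μ = 0) (h1 : ∫ x, h x * m x ∂μ = 0) :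
    ∫ x, h x * degradedDensity m p δ μ (m x) ∂μ = 0 := by
  have hsmall : ∀ᶠ t in 𝓝 (0 : ℝ), |t| * H < 1 :=
    (continuous_abs.mul continuous_const).continuousAt.eventually_lt continuousAt_const (by simp)
  exact eq_zero_of_eventually_mul_le_sq <| hsmall.mono fun t ht =>
    hm.mul_integral_degradedDensity_le hd hopt hh hH h0 h1 ht.le

theorem memLp_comp (hm : IsIntensity m μ l M) {g : ℝ → ℝ} (hg : Continuous g) :
    MemLp (fun x => g (m x)) 2 μ := by
  obtain ⟨C, hC⟩ := isCompact_Icc.exists_bound_of_continuousOn (hg.continuousOn (s := Icc l M))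
  exact .of_bound (hg.measurable.comp hm.measurable).aestronglyMeasurable C
    (hm.ae_mem.mono fun x hx => hC _ hx)

/-- A direction orthogonal to the constants and to `m` is orthogonal to the density; the residual of
the regression of the density on `m` is such a direction. -/
theorem exists_degradedDensity_ae_eq_affine (hm : IsIntensity m μ l M)
    (hd : IsStrictDegradation p δ) (hopt : IsLocallyOptimal m p δ μ) :
    ∃ s₀ s₁ : ℝ, ∀ᵐ x ∂μ, degradedDensity m p δ μ (m x) = s₀ + s₁ * m x := by
  have hD := hm.continuous_degradedDensity hd
  have hD_mem := hm.memLp_comp hD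
  have hm_mem := hm.memLp_comp continuous_id'
  obtain ⟨s, hs⟩ := exists_covariance_sub_mul_eq_zero hm_mem hD_mem
  set I := ∫ x, (degradedDensity m p δ μ (m x) - s * m x) ∂μ
  have hres : Continuous fun r => degradedDensity m p δ μ r - s * r := by fun_prop
  have hres_mem := hm.memLp_comp hres
  have hdir : Continuous fun r => degradedDensity m p δ μ r - s * r - I := hres.sub continuous_const
  obtain ⟨H, hH⟩ := isCompact_Icc.exists_bound_of_continuousOn (hdir.continuousOn (s := Icc l M))
  have horth := hm.integral_mul_degradedDensity_eq_zero hd hopt (hdir.measurable.comp hm.measurable)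
    (hm.ae_mem.mono fun x hx => hH _ hx)
    (by simpa [covariance_const_right] using
      (covariance_eq_integral_sub_mul hres_mem (memLp_const 1)).symm)
    ((covariance_eq_integral_sub_mul hres_mem hm_mem).symm.trans hs)
  have hae := ae_eq_const_of_covariance_eq_zero hm_mem hD_mem hs
    ((covariance_eq_integral_sub_mul hres_mem hD_mem).trans horth)
  exact ⟨I, s, hae.mono fun x hx => sub_eq_iff_eq_add.1 hx⟩

end IsIntensity

end Optimality

/-! ### Finiteness of the support -/

theorem not_differentiableAt_of_eqOn_mul_log {ψ : ℝ → ℝ} (h : EqOn ψ (fun r => r * log r) (Ioi 0)) :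
    ¬ DifferentiableAt ℝ ψ 0 := by
  intro hψ
  have hdiff : DifferentiableWithinAt ℝ (fun r => ψ r + 1 - r) (Ioi 0) 0 :=
    ((hψ.add_const 1).sub differentiableAt_id).differentiableWithinAt
  have heq : EqOn klFun (fun r => ψ r + 1 - r) (Ioi 0) := fun r hr => by
    simp only [klFun_apply, h hr]
  have hklFun : Tendsto klFun (𝓝[>] 0) (𝓝 (klFun 0)) :=
    continuous_klFun.continuousAt.tendsto.mono_left nhdsWithin_le_nhds
  have hψ_lim : Tendsto klFun (𝓝[>] 0) (𝓝 (ψ 0 + 1 - 0)) :=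
    hdiff.continuousWithinAt.tendsto.congr' heq.symm.eventuallyEq_nhdsWithin
  exact not_differentiableWithinAt_klFun_Ioi_zero
    (hdiff.congr heq (tendsto_nhds_unique hklFun hψ_lim))

namespace IsStrictDegradation

variable {p δ : ℝ} {ψ : ℝ → ℝ}

theorem not_differentiableAt_of_eqOn (hd : IsStrictDegradation p δ)
    (h : EqOn ψ (fun r => r * log r - (p * r + δ) * log (p * r + δ)) (Ioi 0)) :
    ¬ DifferentiableAt ℝ ψ 0 := by
  intro hψ
  rcases hd.nonneg.eq_or_lt with rfl | hδ
  · have hp : 0 < 1 - p := sub_pos.2 (hd.strict.resolve_right (lt_irrefl _))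
    refine not_differentiableAt_of_eqOn_mul_log
      (ψ := fun r => (ψ r + p * r * log p) / (1 - p)) (fun r hr => ?_) (by fun_prop)
    simp only [h hr, add_zero, log_mul hd.pos.ne' (ne_of_gt hr)]
    rw [div_eq_iff hp.ne']
    ring
  · have hδ' : p * 0 + δ ≠ 0 := by simpa using hδ.ne'
    refine not_differentiableAt_of_eqOn_mul_log
      (ψ := fun r => ψ r + (p * r + δ) * log (p * r + δ)) (fun r hr => ?_)
      (by fun_prop (disch := assumption))
    simp only [h hr, sub_add_cancel]

/-- Two functions analytic on `(0, ∞)` which agree infinitely often on a compact subset agree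
everywhere on `(0, ∞)`, but `ψ` is differentiable at `0` and the other function is not. -/
theorem finite_setOf_eq (hd : IsStrictDegradation p δ) (hψ : ∀ r, AnalyticAt ℝ ψ r) {K : Set ℝ}
    (hK : IsCompact K) (hpos : K ⊆ Ioi 0) :
    {r ∈ K | ψ r = r * log r - (p * r + δ) * log (p * r + δ)}.Finite := by
  by_contra hinf
  obtain ⟨r₀, hr₀, hacc⟩ := Set.Infinite.exists_accPt_of_subset_isCompact hinf hK (sep_subset _ _)
  have hanalytic : AnalyticOnNhd ℝ (fun r => r * log r - (p * r + δ) * log (p * r + δ)) (Ioi 0) :=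
    fun r hr => by
      have hr' : 0 < p * r + δ := add_pos_of_pos_of_nonneg (mul_pos hd.pos hr) hd.nonneg
      have hlin : AnalyticAt ℝ (fun r => p * r + δ) r := by fun_prop
      exact (analyticAt_id.mul (analyticAt_log hr)).sub (hlin.mul (hlin.log hr'))
  exact hd.not_differentiableAt_of_eqOn (AnalyticOnNhd.eqOn_of_preconnected_of_frequently_eq
    (fun r _ => hψ r) hanalytic isPreconnected_Ioi (hpos hr₀)
    ((accPt_iff_frequently_nhdsNE.1 hacc).mono fun r hr => hr.2)) (hψ 0).differentiableAt

end IsStrictDegradation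

section Support

variable {X : Type*} [MeasurableSpace X] {m : X → ℝ} {μ : Measure X} [IsProbabilityMeasure μ]
  {l M p δ : ℝ}

theorem IsIntensity.finite_setOf_degradedDensity_eq_affine (hm : IsIntensity m μ l M)
    (hd : IsStrictDegradation p δ) (s₀ s₁ : ℝ) :
    {r ∈ Icc l M | degradedDensity m p δ μ r = s₀ + s₁ * r}.Finite := by
  have hm' := hm.mul_add hd.pos hd.nonneg
  have hψ : ∀ r, AnalyticAt ℝ (fun r => s₀ + s₁ * r + (r + poissonAverage (logOutput m μ) r) -
      ((p * r + δ) + poissonAverage (logOutput (fun x => p * m x + δ) μ) (p * r + δ))) r :=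
    fun r => by
      have hlin : AnalyticAt ℝ (fun r => p * r + δ) r := by fun_prop
      have haff : AnalyticAt ℝ (fun r => s₀ + s₁ * r) r := by fun_prop
      exact (haff.add (analyticAt_id.add
        (hm.poissonSummable_logOutput.analyticAt_poissonAverage r))).sub (hlin.add
          ((hm'.poissonSummable_logOutput.analyticAt_poissonAverage _).fun_comp hlin))
  refine (hd.finite_setOf_eq hψ isCompact_Icc fun r hr => hm.pos.trans_le hr.1).subset
    fun r hr => ⟨hr.1, ?_⟩
  have hr' := hr.2
  simp only [degradedDensity, infoDensity] at hr'
  linarith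

theorem IsIntensity.finite_support [TopologicalSpace X] (hm : IsIntensity m μ l M)
    (hd : IsStrictDegradation p δ) (hopt : IsLocallyOptimal m p δ μ) (hmc : Continuous m)
    (hinj : m.Injective) : μ.support.Finite := by
  obtain ⟨s₀, s₁, hs⟩ := hm.exists_degradedDensity_ae_eq_affine hd hopt
  have hfin := hm.finite_setOf_degradedDensity_eq_affine hd s₀ s₁
  refine (hfin.preimage hinj.injOn).subset
    (Measure.support_subset_of_isClosed (hfin.isClosed.preimage hmc) ?_)
  filter_upwards [hm.ae_mem, hs] with x hx hsx using ⟨hx, hsx⟩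

end Support

/-! ### The degraded wiretap channel -/

/-- The mean of the output of `channel α lam Δ` as a real number. Unlike the mean
used to define the channel, it is not truncated at zero, so that it is affine in `x`. -/
def channelMean (α lam Δ x : ℝ) : ℝ :=
  (α * x + lam) * Δ

/-- The parameters of a degraded Poisson wiretap channel: the eavesdropper's gain is at most, and
her ratio of dark current to gain at least, that of the legitimate receiver. By `strict` the two
receivers are not equally good. -/
structure IsDegradedWiretap (αB αE lamB lamE Δ : ℝ) : Prop where
  gainB_pos : 0 < αB
  gainE_pos : 0 < αE
  darkB_pos : 0 < lamB
  darkE_pos : 0 < lamE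
  slot_pos : 0 < Δ
  gain_le : αE ≤ αB
  ratio_le : lamB / αB ≤ lamE / αE
  strict : αE < αB ∨ lamB / αB < lamE / αE

section Channel

variable {α lam Δ A E : ℝ} {μ ν : ProbabilityMeasure ℝ}

theorem continuous_channelMean (α lam Δ : ℝ) : Continuous (channelMean α lam Δ) := by
  unfold channelMean
  fun_prop

theorem injective_channelMean (hα : α ≠ 0) (hΔ : Δ ≠ 0) :
    (channelMean α lam Δ).Injective := fun x y hxy => by
  simpa [channelMean, hα, hΔ] using hxy

theorem mapsTo_channelMean (hα : 0 ≤ α) (hΔ : 0 ≤ Δ) :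
    MapsTo (channelMean α lam Δ) (Icc 0 A) (Icc (lam * Δ) ((α * A + lam) * Δ)) := fun x hx => by
  have hx0 : 0 ≤ α * x := mul_nonneg hα hx.1
  refine ⟨?_, ?_⟩ <;> unfold channelMean <;> gcongr
  · linarith
  · exact hx.2

theorem ae_mem_Icc_of_mem_feasible (hμ : μ ∈ feasible A E) :
    ∀ᵐ x ∂(μ : Measure ℝ), x ∈ Icc 0 A :=
  (mem_ae_iff_prob_eq_one measurableSet_Icc).2 hμ.1

theorem mem_feasible_of_ae (h : ∀ᵐ x ∂(μ : Measure ℝ), x ∈ Icc 0 A)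
    (hE : ∫ x, x ∂(μ : Measure ℝ) ≤ E) : μ ∈ feasible A E :=
  ⟨(mem_ae_iff_prob_eq_one measurableSet_Icc).1 h, hE⟩

theorem dirac_zero_mem_feasible (hA : 0 ≤ A) (hE : 0 ≤ E) :
    (⟨Measure.dirac 0, inferInstance⟩ : ProbabilityMeasure ℝ) ∈ feasible A E := by
  refine mem_feasible_of_ae ?_ (by simpa using hE)
  rw [ProbabilityMeasure.coe_mk, ae_dirac_eq, eventually_pure]
  exact ⟨le_rfl, hA⟩

theorem isCompact_feasible (A E : ℝ) : IsCompact (feasible A E) := by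
  have hK := isCompact_setOf_measure_eq_one (isCompact_Icc (a := (0 : ℝ)) (b := A))
  exact hK.of_isClosed_subset
    ((continuousOn_integral isCompact_Icc continuousOn_id).preimage_isClosed_of_isClosed
      hK.isClosed (isClosed_Iic (a := E))) inter_subset_left

theorem integrable_id_of_ae_mem_Icc {μ : Measure ℝ} [IsFiniteMeasure μ]
    (h : ∀ᵐ x ∂μ, x ∈ Icc 0 A) : Integrable (fun x => x) μ :=
  .of_bound measurable_id.aestronglyMeasurable A <| h.mono fun _ hx =>
    (abs_of_nonneg hx.1).trans_le hx.2

theorem integral_channelMean {μ : Measure ℝ} [IsProbabilityMeasure μ]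
    (h : Integrable (fun x => x) μ) :
    ∫ x, channelMean α lam Δ x ∂μ = channelMean α lam Δ (∫ x, x ∂μ) := by
  simp only [channelMean]
  rw [integral_mul_const, integral_add (h.const_mul α) (integrable_const lam), integral_const_mul]
  simp

theorem midpointMeasure_mem_feasible (hμ : μ ∈ feasible A E) (hν : ν ∈ feasible A E) :
    (⟨midpointMeasure (μ : Measure ℝ) ν, inferInstance⟩ : ProbabilityMeasure ℝ) ∈ feasible A E := by
  have hμ_mem := ae_mem_Icc_of_mem_feasible hμ
  have hν_mem := ae_mem_Icc_of_mem_feasible hν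
  refine mem_feasible_of_ae (ae_midpointMeasure hμ_mem hν_mem) ?_
  rw [ProbabilityMeasure.coe_mk, integral_midpointMeasure (integrable_id_of_ae_mem_Icc hμ_mem)
    (integrable_id_of_ae_mem_Icc hν_mem)]
  linarith [hμ.2, hν.2]

theorem isIntensity_channelMean (hα : 0 ≤ α) (hlam : 0 < lam) (hΔ : 0 < Δ)
    (hμ : μ ∈ feasible A E) :
    IsIntensity (channelMean α lam Δ) (μ : Measure ℝ) (lam * Δ) ((α * A + lam) * Δ) where
  measurable := (continuous_channelMean α lam Δ).measurable
  pos := mul_pos hlam hΔ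
  ae_mem := (ae_mem_Icc_of_mem_feasible hμ).mono fun _ hx => mapsTo_channelMean hα hΔ.le hx

theorem mutualInfo_channel_ne_top (hα : 0 ≤ α) (hlam : 0 < lam) (hΔ : 0 < Δ)
    (hμ : μ ∈ feasible A E) : mutualInfo (μ : Measure ℝ) (channel α lam Δ) ≠ ∞ :=
  (isIntensity_channelMean hα hlam hΔ hμ).mutualInfo_ne_top fun _ => rfl

theorem toReal_mutualInfo_channel (hα : 0 ≤ α) (hlam : 0 < lam) (hΔ : 0 < Δ)
    (hμ : μ ∈ feasible A E) :
    (mutualInfo (μ : Measure ℝ) (channel α lam Δ)).toReal = infoRate (channelMean α lam Δ) μ :=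
  (isIntensity_channelMean hα hlam hΔ hμ).toReal_mutualInfo fun _ => rfl

theorem continuousOn_toReal_mutualInfo_channel (hα : 0 ≤ α) (hlam : 0 < lam) (hΔ : 0 < Δ) :
    ContinuousOn (fun μ : ProbabilityMeasure ℝ =>
      (mutualInfo (μ : Measure ℝ) (channel α lam Δ)).toReal) (feasible A E) :=
  ((continuousOn_infoRate isCompact_Icc (continuous_channelMean α lam Δ).measurable
    (continuous_channelMean α lam Δ).continuousOn (mul_pos hlam hΔ)
    (mapsTo_channelMean hα hΔ.le)).mono inter_subset_left).congr fun _ hμ =>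
      toReal_mutualInfo_channel hα hlam hΔ hμ

end Channel

namespace IsDegradedWiretap

variable {αB αE lamB lamE Δ A E : ℝ} {μ ν : ProbabilityMeasure ℝ}

theorem channelMean_eq (h : IsDegradedWiretap αB αE lamB lamE Δ) :
    channelMean αE lamE Δ =
      fun x => αE / αB * channelMean αB lamB Δ x + (lamE - αE / αB * lamB) * Δ := by
  have hαB := h.gainB_pos.ne'
  funext x
  simp only [channelMean]
  field_simp
  ring

theorem isStrictDegradation (h : IsDegradedWiretap αB αE lamB lamE Δ) :
    IsStrictDegradation (αE / αB) ((lamE - αE / αB * lamB) * Δ) := by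
  have hαB := h.gainB_pos
  have hαE := h.gainE_pos
  have hδ : (lamE - αE / αB * lamB) * Δ = αE * Δ * (lamE / αE - lamB / αB) := by field_simp
  have hαEΔ : 0 < αE * Δ := mul_pos hαE h.slot_pos
  exact
    { pos := div_pos hαE hαB
      le_one := (div_le_one hαB).2 h.gain_le
      nonneg := hδ ▸ mul_nonneg hαEΔ.le (sub_nonneg.2 h.ratio_le)
      strict := h.strict.imp (div_lt_one hαB).2 fun hlt => hδ ▸ mul_pos hαEΔ (sub_pos.2 hlt) }

theorem isIntensity (h : IsDegradedWiretap αB αE lamB lamE Δ) (hμ : μ ∈ feasible A E) :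
    IsIntensity (channelMean αB lamB Δ) (μ : Measure ℝ) (lamB * Δ) ((αB * A + lamB) * Δ) :=
  isIntensity_channelMean h.gainB_pos.le h.darkB_pos h.slot_pos hμ

theorem secrecyRate_eq (h : IsDegradedWiretap αB αE lamB lamE Δ) (hμ : μ ∈ feasible A E) :
    secrecyRate (channel αB lamB Δ) (channel αE lamE Δ) μ =
      degradedRate (channelMean αB lamB Δ) (αE / αB) ((lamE - αE / αB * lamB) * Δ) μ := by
  rw [secrecyRate, toReal_mutualInfo_channel h.gainB_pos.le h.darkB_pos h.slot_pos hμ,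
    toReal_mutualInfo_channel h.gainE_pos.le h.darkE_pos h.slot_pos hμ, degradedRate,
    h.channelMean_eq]

theorem continuousOn_secrecyRate (h : IsDegradedWiretap αB αE lamB lamE Δ) :
    ContinuousOn (secrecyRate (channel αB lamB Δ) (channel αE lamE Δ)) (feasible A E) :=
  (continuousOn_toReal_mutualInfo_channel h.gainB_pos.le h.darkB_pos h.slot_pos).sub
    (continuousOn_toReal_mutualInfo_channel h.gainE_pos.le h.darkE_pos h.slot_pos)

theorem eq_of_isMaxOn (h : IsDegradedWiretap αB αE lamB lamE Δ)
    (hμ : μ ∈ feasible A E) (hν : ν ∈ feasible A E)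
    (hμmax : IsMaxOn (secrecyRate (channel αB lamB Δ) (channel αE lamE Δ)) (feasible A E) μ)
    (hνmax : IsMaxOn (secrecyRate (channel αB lamB Δ) (channel αE lamE Δ)) (feasible A E) ν) :
    ν = μ := by
  by_contra hne
  have hemb : MeasurableEmbedding (channelMean αB lamB Δ) :=
    (continuous_channelMean αB lamB Δ).measurableEmbedding
      (injective_channelMean h.gainB_pos.ne' h.slot_pos.ne')
  have hmid := midpointMeasure_mem_feasible hν hμ
  have hlt := (h.isIntensity hν).degradedRate_midpoint_lt (h.isIntensity hμ) h.isStrictDegradation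
    hemb (fun heq => hne (Subtype.ext heq))
  rw [← h.secrecyRate_eq hν, ← h.secrecyRate_eq hμ] at hlt
  have hrate := h.secrecyRate_eq hmid
  rw [ProbabilityMeasure.coe_mk] at hrate
  linarith [isMaxOn_iff.1 hνmax _ hmid, isMaxOn_iff.1 hμmax _ hmid]

theorem isLocallyOptimal_of_isMaxOn (h : IsDegradedWiretap αB αE lamB lamE Δ)
    (hμ : μ ∈ feasible A E)
    (hmax : IsMaxOn (secrecyRate (channel αB lamB Δ) (channel αE lamE Δ)) (feasible A E) μ) :
    IsLocallyOptimal (channelMean αB lamB Δ) (αE / αB) ((lamE - αE / αB * lamB) * Δ)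
      (μ : Measure ℝ) := by
  intro ν hν hac hmean
  have hμ_mem := ae_mem_Icc_of_mem_feasible hμ
  have hν_mem := hac.ae_le hμ_mem
  rw [integral_channelMean (integrable_id_of_ae_mem_Icc hν_mem),
    integral_channelMean (integrable_id_of_ae_mem_Icc hμ_mem)] at hmean
  have hfeas : (⟨ν, hν⟩ : ProbabilityMeasure ℝ) ∈ feasible A E := mem_feasible_of_ae hν_mem <|
    (injective_channelMean h.gainB_pos.ne' h.slot_pos.ne' hmean).trans_le hμ.2
  rw [← h.secrecyRate_eq hμ]
  exact (h.secrecyRate_eq hfeas).symm.trans_le (isMaxOn_iff.1 hmax _ hfeas)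

theorem finite_support_of_isMaxOn (h : IsDegradedWiretap αB αE lamB lamE Δ)
    (hμ : μ ∈ feasible A E)
    (hmax : IsMaxOn (secrecyRate (channel αB lamB Δ) (channel αE lamE Δ)) (feasible A E) μ) :
    (μ : Measure ℝ).support.Finite :=
  (h.isIntensity hμ).finite_support h.isStrictDegradation (h.isLocallyOptimal_of_isMaxOn hμ hmax)
    (continuous_channelMean αB lamB Δ) (injective_channelMean h.gainB_pos.ne' h.slot_pos.ne')

end IsDegradedWiretap

end PoissonWiretap

theorem theorem1 (αB αE lamB lamE Δ A E : ℝ)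
    (hαB : 0 < αB) (hαE : 0 < αE) (hlamB : 0 < lamB) (hlamE : 0 < lamE) (hΔ : 0 < Δ)
    (hA : 0 ≤ A) (hE : 0 ≤ E)
    (hdeg1 : αE ≤ αB) (hdeg2 : lamB / αB ≤ lamE / αE)
    (hstrict : αE < αB ∨ lamB / αB < lamE / αE) :
    -- both mutual informations are finite, and the supremum is that of a bounded set
    (∀ μ ∈ PoissonWiretap.feasible A E,
      PoissonWiretap.mutualInfo (μ : Measure ℝ) (PoissonWiretap.channel αB lamB Δ) ≠ ∞ ∧
      PoissonWiretap.mutualInfo (μ : Measure ℝ) (PoissonWiretap.channel αE lamE Δ) ≠ ∞) ∧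
    BddAbove (PoissonWiretap.secrecyRate (PoissonWiretap.channel αB lamB Δ)
      (PoissonWiretap.channel αE lamE Δ) '' PoissonWiretap.feasible A E) ∧
    -- there is exactly one optimal input law, and its support is finite
    ∃ μ : ProbabilityMeasure ℝ,
      (μ ∈ PoissonWiretap.feasible A E ∧
        PoissonWiretap.secrecyRate (PoissonWiretap.channel αB lamB Δ)
            (PoissonWiretap.channel αE lamE Δ) μ =
          PoissonWiretap.secrecyCapacity (PoissonWiretap.channel αB lamB Δ)
            (PoissonWiretap.channel αE lamE Δ) A E) ∧
      (∀ ν ∈ PoissonWiretap.feasible A E,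
        PoissonWiretap.secrecyRate (PoissonWiretap.channel αB lamB Δ)
            (PoissonWiretap.channel αE lamE Δ) ν =
          PoissonWiretap.secrecyCapacity (PoissonWiretap.channel αB lamB Δ)
            (PoissonWiretap.channel αE lamE Δ) A E → ν = μ) ∧
      (μ : Measure ℝ).support.Finite := by
  open PoissonWiretap in
  have h : IsDegradedWiretap αB αE lamB lamE Δ :=
    ⟨hαB, hαE, hlamB, hlamE, hΔ, hdeg1, hdeg2, hstrict⟩
  have hcpt := isCompact_feasible A E
  have hcont := h.continuousOn_secrecyRate (A := A) (E := E)
  refine ⟨fun μ hμ => ⟨mutualInfo_channel_ne_top hαB.le hlamB hΔ hμ,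
    mutualInfo_channel_ne_top hαE.le hlamE hΔ hμ⟩,
    (hcpt.image_of_continuousOn hcont).bddAbove, ?_⟩
  obtain ⟨μ, hμ, hmax⟩ := hcpt.exists_isMaxOn ⟨_, dirac_zero_mem_feasible hA hE⟩ hcont
  have hcap : secrecyCapacity (channel αB lamB Δ) (channel αE lamE Δ) A E =
      secrecyRate (channel αB lamB Δ) (channel αE lamE Δ) μ :=
    IsGreatest.csSup_eq ⟨Set.mem_image_of_mem _ hμ, Set.forall_mem_image.2 hmax⟩
  refine ⟨μ, ⟨hμ, hcap.symm⟩, fun ν hν hνcap => ?_, h.finite_support_of_isMaxOn hμ hmax⟩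
  have hνmax : IsMaxOn (secrecyRate (channel αB lamB Δ) (channel αE lamE Δ)) (feasible A E) ν :=
    fun ρ hρ => (hmax hρ).trans_eq (hcap.symm.trans hνcap.symm)
  exact h.eq_of_isMaxOn hμ hν hmax hνmax
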